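/- All operads are nonsymmetric operads in (differential) graded $\mathbb Z$-modules, with homological degrees and the Koszul sign rule. Let $\mathrm{cA}_\infty$ be the dg operad which is free as a graded operad on generators $\mu_n$, $n\ge 0$, of arity $n$ and degree $-1$, with differential $$d\mu_n=-\sum_{\substack{p+q+r=n\\ p,q,r\ge 0}}\mu_{p+1+r}\circ_{p+1}\mu_q .$$ Let $\mathrm T$ be the dg operad freely generated by two operations of arity $0$, $\alpha$ of degree $0$ and $\kappa$ of degree $-1$, with $d\alpha=\kappa$ and $d\kappa=0$. Let $\mathrm{cA}_\infty\,\hat\vee\,\mathrm T$ be the completion of the coproduct $\mathrm{cA}_\infty\vee\mathrm T$ of dg operads with respect to the filtration by the number of $\alpha$ (formed in each arity and degree). **Proposition.** There is a morphism of nonsymmetric dg operads $\eta:\mathrm{cA}_\infty\to\mathrm{cA}_\infty\,\hat\vee\,\mathrm T$, necessarily unique, such that $$\eta(\mu_0)=\kappa+\sum_{k\ge 0}\mu_k(\alpha,\dots,\alpha),$$ $$\eta(\mu_n)=\sum_{i_1,\dots,i_{n+1}\ge 0}\mu_{n+i_1+\cdots+i_{n+1}}(\alpha^{i_1},-,\alpha^{i_2},-,\dots,-,\alpha^{i_{n+1}})\qquad(n\ge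 1).$$ That is, the morphism of graded operads defined on the free generators by these formulas commutes with the differentials. -/

import Mathlib

/-! ### Nonsymmetric graded and dg operads over `ℤ` -/

/-- The Koszul sign `(-1)^a`, as an integer. -/
def ksign (a : ℤ) : ℤ := ((Int.negOnePow a : ℤˣ) : ℤ)

/-- A nonsymmetric operad in graded `ℤ`-modules, in the partial composition presentation.
`obj n a` is the group of operations of arity `n` and (homological) degree `a`.
`comp i _ _ _ x y` is the partial composition plugging `y` into the input number `i` of `x`;
the inputs are numbered from `0`, so this is what is usually written `x ∘_{i+1} y`.
The arity `k = m + n - 1` and the degree `c = a + b` of the result are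
recorded by equations, so that no transport along equalities of indices is needed. -/
structure NSOperad where
  obj : ℕ → ℤ → Type
  [grp : ∀ n a, AddCommGroup (obj n a)]
  one : obj 1 0
  comp : ∀ {m n k : ℕ} {a b c : ℤ} (i : ℕ), i < m → k + 1 = m + n → a + b = c →
    obj m a → obj n b → obj k c
  add_comp : ∀ {m n k : ℕ} {a b c : ℤ} (i : ℕ) (hi : i < m) (hk : k + 1 = m + n)
    (hc : a + b = c) (x x' : obj m a) (y : obj n b),
    comp i hi hk hc (x + x') y = comp i hi hk hc x y + comp i hi hk hc x' y
  comp_add : ∀ {m n k : ℕ} {a b c : ℤ} (i : ℕ) (hi : i < m) (hk : k + 1 = m + n)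
    (hc : a + b = c) (x : obj m a) (y y' : obj n b),
    comp i hi hk hc x (y + y') = comp i hi hk hc x y + comp i hi hk hc x y'
  one_comp : ∀ {n : ℕ} {a : ℤ} (hk : n + 1 = 1 + n) (y : obj n a),
    comp 0 one_pos hk (zero_add a) one y = y
  comp_one : ∀ {m : ℕ} {a : ℤ} (i : ℕ) (hi : i < m) (x : obj m a),
    comp i hi rfl (add_zero a) x one = x
  /-- Sequential composition: `(x ∘_i y) ∘_{i + j} z = x ∘_i (y ∘_j z)` (inputs from `0`). -/
  comp_seq : ∀ {l m n k₁ k₂ k : ℕ} {a b c ab bc abc : ℤ} (i j : ℕ) (hi : i < l) (hj : j < m)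
    (hij : i + j < k₁) (h₁ : k₁ + 1 = l + m) (h : k + 1 = k₁ + n)
    (h₂ : k₂ + 1 = m + n) (h' : k + 1 = l + k₂)
    (hab : a + b = ab) (habc : ab + c = abc) (hbc : b + c = bc) (habc' : a + bc = abc)
    (x : obj l a) (y : obj m b) (z : obj n c),
    comp (i + j) hij h habc (comp i hi h₁ hab x y) z
      = comp i hi h' habc' x (comp j hj h₂ hbc y z)
  /-- Parallel composition: for `i < j`,
  `(x ∘_i y) ∘_{j - 1 + |y|} z = (-1)^{deg y deg z} (x ∘_j z) ∘_i y` (inputs from `0`). -/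
  comp_par : ∀ {l m n k₁ k₂ k : ℕ} {a b c ab ac abc : ℤ} (i j j' : ℕ) (_hlt : i < j)
    (_hj' : j' + 1 = j + m) (hi : i < l) (hj : j < l) (hj₁ : j' < k₁) (hi₂ : i < k₂)
    (h₁ : k₁ + 1 = l + m) (h : k + 1 = k₁ + n) (h₂ : k₂ + 1 = l + n) (h' : k + 1 = k₂ + m)
    (hab : a + b = ab) (habc : ab + c = abc) (hac : a + c = ac) (habc' : ac + b = abc)
    (x : obj l a) (y : obj m b) (z : obj n c),
    comp j' hj₁ h habc (comp i hi h₁ hab x y) z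
      = ksign (b * c) • comp i hi₂ h' habc' (comp j hj h₂ hac x z) y

attribute [instance] NSOperad.grp

/-- A nonsymmetric dg operad over `ℤ`: a graded operad with a differential of degree `-1` which
squares to zero and is a derivation for the partial compositions. -/
structure DGOperad extends NSOperad where
  d : ∀ {n : ℕ} {a : ℤ}, obj n a →+ obj n (a - 1)
  d_d : ∀ {n : ℕ} {a : ℤ} (x : obj n a), d (d x) = 0
  d_comp : ∀ {m n k : ℕ} {a b c : ℤ} (i : ℕ) (hi : i < m) (hk : k + 1 = m + n)
    (hc : a + b = c) (h₁ : a - 1 + b = c - 1) (h₂ : a + (b - 1) = c - 1)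
    (x : obj m a) (y : obj n b),
    d (comp i hi hk hc x y)
      = comp i hi hk h₁ (d x) y + ksign a • comp i hi hk h₂ x (d y)

/-- Morphisms of nonsymmetric dg operads. -/
@[ext]
structure DGOperad.Hom (P Q : DGOperad) where
  map : ∀ {n : ℕ} {a : ℤ}, P.obj n a →+ Q.obj n a
  map_one : map P.one = Q.one
  map_comp : ∀ {m n k : ℕ} {a b c : ℤ} (i : ℕ) (hi : i < m) (hk : k + 1 = m + n)
    (hc : a + b = c) (x : P.obj m a) (y : P.obj n b),
    map (P.comp i hi hk hc x y) = Q.comp i hi hk hc (map x) (map y)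
  map_d : ∀ {n : ℕ} {a : ℤ} (x : P.obj n a), map (P.d x) = Q.d (map x)

namespace NSOperad

/-- Partial composition as a biadditive map. -/
def compHom (P : NSOperad) {m n k : ℕ} {a b c : ℤ} (i : ℕ) (hi : i < m) (hk : k + 1 = m + n)
    (hc : a + b = c) : P.obj m a →+ P.obj n b →+ P.obj k c :=
  AddMonoidHom.mk' (fun x => AddMonoidHom.mk' (fun y => P.comp i hi hk hc x y)
    (fun y y' => P.comp_add i hi hk hc x y y'))
    (fun x x' => by ext y; exact P.add_comp i hi hk hc x x' y)

section
variable (P : NSOperad) {m n k : ℕ} {a b c : ℤ} (i : ℕ) (hi : i < m) (hk : k + 1 = m + n)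
  (hc : a + b = c)

theorem zero_comp (y : P.obj n b) : P.comp i hi hk hc (0 : P.obj m a) y = 0 :=
  DFunLike.congr_fun (map_zero (P.compHom i hi hk hc)) y

theorem comp_zero (x : P.obj m a) : P.comp i hi hk hc x (0 : P.obj n b) = 0 :=
  map_zero (P.compHom i hi hk hc x)

theorem neg_comp (x : P.obj m a) (y : P.obj n b) :
    P.comp i hi hk hc (-x) y = -P.comp i hi hk hc x y :=
  DFunLike.congr_fun (map_neg (P.compHom i hi hk hc) x) y

theorem comp_neg (x : P.obj m a) (y : P.obj n b) :
    P.comp i hi hk hc x (-y) = -P.comp i hi hk hc x y :=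
  map_neg (P.compHom i hi hk hc x) y

theorem zsmul_comp (t : ℤ) (x : P.obj m a) (y : P.obj n b) :
    P.comp i hi hk hc (t • x) y = t • P.comp i hi hk hc x y :=
  DFunLike.congr_fun (map_zsmul (P.compHom i hi hk hc) t x) y

theorem comp_zsmul (t : ℤ) (x : P.obj m a) (y : P.obj n b) :
    P.comp i hi hk hc x (t • y) = t • P.comp i hi hk hc x y :=
  map_zsmul (P.compHom i hi hk hc x) t y

theorem sum_comp {ι : Type*} (s : Finset ι) (f : ι → P.obj m a) (y : P.obj n b) :
    P.comp i hi hk hc (∑ t ∈ s, f t) y = ∑ t ∈ s, P.comp i hi hk hc (f t) y := by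
  have h := DFunLike.congr_fun (map_sum (P.compHom i hi hk hc) f s) y
  rwa [AddMonoidHom.finsetSum_apply] at h

theorem comp_sum {ι : Type*} (s : Finset ι) (x : P.obj m a) (f : ι → P.obj n b) :
    P.comp i hi hk hc x (∑ t ∈ s, f t) = ∑ t ∈ s, P.comp i hi hk hc x (f t) :=
  map_sum (P.compHom i hi hk hc x) f s

end

end NSOperad

/-! ### Operads by generators and relations -/

/-- Formal operadic expressions in the generators `G n a` (of arity `n` and degree `a`). -/
inductive OpTerm (G : ℕ → ℤ → Type) : ℕ → ℤ → Type
  | gen {n : ℕ} {a : ℤ} (g : G n a) : OpTerm G n a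
  | one : OpTerm G 1 0
  | zero {n : ℕ} {a : ℤ} : OpTerm G n a
  | add {n : ℕ} {a : ℤ} (x y : OpTerm G n a) : OpTerm G n a
  | neg {n : ℕ} {a : ℤ} (x : OpTerm G n a) : OpTerm G n a
  | comp {m n k : ℕ} {a b c : ℤ} (i : ℕ) (hi : i < m) (hk : k + 1 = m + n) (hc : a + b = c)
      (x : OpTerm G m a) (y : OpTerm G n b) : OpTerm G k c

/-- The congruence on operadic expressions generated by the axioms of a graded nonsymmetric
operad and the additional relations `r`. -/
inductive OpRel {G : ℕ → ℤ → Type} (r : ∀ (n : ℕ) (a : ℤ), OpTerm G n a → OpTerm G n a → Prop) :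
    ∀ {n : ℕ} {a : ℤ}, OpTerm G n a → OpTerm G n a → Prop
  | of {n : ℕ} {a : ℤ} {x y : OpTerm G n a} : r n a x y → OpRel r x y
  | refl {n : ℕ} {a : ℤ} (x : OpTerm G n a) : OpRel r x x
  | symm {n : ℕ} {a : ℤ} {x y : OpTerm G n a} : OpRel r x y → OpRel r y x
  | trans {n : ℕ} {a : ℤ} {x y z : OpTerm G n a} : OpRel r x y → OpRel r y z → OpRel r x z
  | add_congr {n : ℕ} {a : ℤ} {x x' y y' : OpTerm G n a} :
      OpRel r x x' → OpRel r y y' → OpRel r (x.add y) (x'.add y')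
  | neg_congr {n : ℕ} {a : ℤ} {x x' : OpTerm G n a} : OpRel r x x' → OpRel r x.neg x'.neg
  | comp_congr {m n k : ℕ} {a b c : ℤ} (i : ℕ) (hi : i < m) (hk : k + 1 = m + n)
      (hc : a + b = c) {x x' : OpTerm G m a} {y y' : OpTerm G n b} :
      OpRel r x x' → OpRel r y y' →
      OpRel r (OpTerm.comp i hi hk hc x y) (OpTerm.comp i hi hk hc x' y')
  | add_assoc {n : ℕ} {a : ℤ} (x y z : OpTerm G n a) :
      OpRel r ((x.add y).add z) (x.add (y.add z))
  | add_comm {n : ℕ} {a : ℤ} (x y : OpTerm G n a) : OpRel r (x.add y) (y.add x)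
  | zero_add {n : ℕ} {a : ℤ} (x : OpTerm G n a) : OpRel r (OpTerm.zero.add x) x
  | neg_add {n : ℕ} {a : ℤ} (x : OpTerm G n a) : OpRel r (x.neg.add x) OpTerm.zero
  | add_comp {m n k : ℕ} {a b c : ℤ} (i : ℕ) (hi : i < m) (hk : k + 1 = m + n)
      (hc : a + b = c) (x x' : OpTerm G m a) (y : OpTerm G n b) :
      OpRel r (OpTerm.comp i hi hk hc (x.add x') y)
        ((OpTerm.comp i hi hk hc x y).add (OpTerm.comp i hi hk hc x' y))
  | comp_add {m n k : ℕ} {a b c : ℤ} (i : ℕ) (hi : i < m) (hk : k + 1 = m + n)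
      (hc : a + b = c) (x : OpTerm G m a) (y y' : OpTerm G n b) :
      OpRel r (OpTerm.comp i hi hk hc x (y.add y'))
        ((OpTerm.comp i hi hk hc x y).add (OpTerm.comp i hi hk hc x y'))
  | one_comp {n : ℕ} {a : ℤ} (hk : n + 1 = 1 + n) (y : OpTerm G n a) :
      OpRel r (OpTerm.comp 0 Nat.one_pos hk (Int.zero_add a) OpTerm.one y) y
  | comp_one {m : ℕ} {a : ℤ} (i : ℕ) (hi : i < m) (x : OpTerm G m a) :
      OpRel r (OpTerm.comp i hi rfl (Int.add_zero a) x OpTerm.one) x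
  | comp_seq {l m n k₁ k₂ k : ℕ} {a b c ab bc abc : ℤ} (i j : ℕ) (hi : i < l) (hj : j < m)
      (hij : i + j < k₁) (h₁ : k₁ + 1 = l + m) (h : k + 1 = k₁ + n)
      (h₂ : k₂ + 1 = m + n) (h' : k + 1 = l + k₂)
      (hab : a + b = ab) (habc : ab + c = abc) (hbc : b + c = bc) (habc' : a + bc = abc)
      (x : OpTerm G l a) (y : OpTerm G m b) (z : OpTerm G n c) :
      OpRel r (OpTerm.comp (i + j) hij h habc (OpTerm.comp i hi h₁ hab x y) z)
        (OpTerm.comp i hi h' habc' x (OpTerm.comp j hj h₂ hbc y z))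
  | comp_par_even {l m n k₁ k₂ k : ℕ} {a b c ab ac abc : ℤ} (i j j' : ℕ) (hlt : i < j)
      (hj' : j' + 1 = j + m) (hi : i < l) (hj : j < l) (hj₁ : j' < k₁) (hi₂ : i < k₂)
      (h₁ : k₁ + 1 = l + m) (h : k + 1 = k₁ + n) (h₂ : k₂ + 1 = l + n) (h' : k + 1 = k₂ + m)
      (hab : a + b = ab) (habc : ab + c = abc) (hac : a + c = ac) (habc' : ac + b = abc)
      (hbc : Even (b * c)) (x : OpTerm G l a) (y : OpTerm G m b) (z : OpTerm G n c) :
      OpRel r (OpTerm.comp j' hj₁ h habc (OpTerm.comp i hi h₁ hab x y) z)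
        (OpTerm.comp i hi₂ h' habc' (OpTerm.comp j hj h₂ hac x z) y)
  | comp_par_odd {l m n k₁ k₂ k : ℕ} {a b c ab ac abc : ℤ} (i j j' : ℕ) (hlt : i < j)
      (hj' : j' + 1 = j + m) (hi : i < l) (hj : j < l) (hj₁ : j' < k₁) (hi₂ : i < k₂)
      (h₁ : k₁ + 1 = l + m) (h : k + 1 = k₁ + n) (h₂ : k₂ + 1 = l + n) (h' : k + 1 = k₂ + m)
      (hab : a + b = ab) (habc : ab + c = abc) (hac : a + c = ac) (habc' : ac + b = abc)
      (hbc : Odd (b * c)) (x : OpTerm G l a) (y : OpTerm G m b) (z : OpTerm G n c) :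
      OpRel r (OpTerm.comp j' hj₁ h habc (OpTerm.comp i hi h₁ hab x y) z)
        (OpTerm.comp i hi₂ h' habc' (OpTerm.comp j hj h₂ hac x z) y).neg

theorem ksign_even {a : ℤ} (h : Even a) : ksign a = 1 := by simp [ksign, Int.negOnePow_even a h]

theorem ksign_odd {a : ℤ} (h : Odd a) : ksign a = -1 := by simp [ksign, Int.negOnePow_odd a h]

theorem ksign_add (a b : ℤ) : ksign (a + b) = ksign a * ksign b := by
  simp [ksign, Int.negOnePow_add]

theorem ksign_sub_one (a : ℤ) : ksign (a - 1) = -ksign a := by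
  simp [ksign, Int.negOnePow_sub]

theorem ksign_mul_self (a : ℤ) : ksign a * ksign a = 1 := by
  rw [← ksign_add]; exact ksign_even ⟨a, rfl⟩

namespace Presented

variable {G : ℕ → ℤ → Type} (r : ∀ (n : ℕ) (a : ℤ), OpTerm G n a → OpTerm G n a → Prop)

/-- The setoid of the congruence `OpRel r`. -/
def setoid (n : ℕ) (a : ℤ) : Setoid (OpTerm G n a) where
  r := OpRel r
  iseqv := ⟨OpRel.refl, OpRel.symm, OpRel.trans⟩

/-- The operations of arity `n` and degree `a` of the operad with generators `G` and
relations `r`. -/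
def Obj (n : ℕ) (a : ℤ) : Type := Quotient (setoid r n a)

instance (n : ℕ) (a : ℤ) : AddCommGroup (Obj r n a) :=
  letI : Add (Obj r n a) :=
    ⟨Quotient.map₂ OpTerm.add fun _ _ h _ _ h' => OpRel.add_congr h h'⟩
  letI : Zero (Obj r n a) := ⟨Quotient.mk _ OpTerm.zero⟩
  letI : Neg (Obj r n a) := ⟨Quotient.map OpTerm.neg fun _ _ h => OpRel.neg_congr h⟩
  have hcomm : ∀ x y : Obj r n a, x + y = y + x := by
    rintro ⟨x⟩ ⟨y⟩; exact Quotient.sound (OpRel.add_comm x y)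
  have hz : ∀ x : Obj r n a, 0 + x = x := by
    rintro ⟨x⟩; exact Quotient.sound (OpRel.zero_add x)
  { add_assoc := by rintro ⟨x⟩ ⟨y⟩ ⟨z⟩; exact Quotient.sound (OpRel.add_assoc x y z)
    zero_add := hz
    add_zero := fun x => by rw [hcomm, hz]
    add_comm := hcomm
    neg_add_cancel := by rintro ⟨x⟩; exact Quotient.sound (OpRel.neg_add x)
    nsmul := nsmulRec
    zsmul := zsmulRec }

/-- The graded nonsymmetric operad with generators `G` and relations `r`. -/
def operad : NSOperad where
  obj := Obj r
  one := Quotient.mk _ OpTerm.one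
  comp i hi hk hc := Quotient.map₂ (OpTerm.comp i hi hk hc)
    fun _ _ h _ _ h' => OpRel.comp_congr i hi hk hc h h'
  add_comp := by
    rintro m n k a b c i hi hk hc ⟨x⟩ ⟨x'⟩ ⟨y⟩
    exact Quotient.sound (OpRel.add_comp i hi hk hc x x' y)
  comp_add := by
    rintro m n k a b c i hi hk hc ⟨x⟩ ⟨y⟩ ⟨y'⟩
    exact Quotient.sound (OpRel.comp_add i hi hk hc x y y')
  one_comp := by
    rintro n a hk ⟨y⟩
    exact Quotient.sound (OpRel.one_comp hk y)
  comp_one := by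
    rintro m a i hi ⟨x⟩
    exact Quotient.sound (OpRel.comp_one i hi x)
  comp_seq := by
    rintro l m n k₁ k₂ k a b c ab bc abc i j hi hj hij h₁ h h₂ h' hab habc hbc habc' ⟨x⟩ ⟨y⟩ ⟨z⟩
    exact Quotient.sound (OpRel.comp_seq i j hi hj hij h₁ h h₂ h' hab habc hbc habc' x y z)
  comp_par := by
    rintro l m n k₁ k₂ k a b c ab ac abc i j j' hlt hj' hi hj hj₁ hi₂ h₁ h h₂ h'
      hab habc hac habc' ⟨x⟩ ⟨y⟩ ⟨z⟩
    rcases Int.even_or_odd (b * c) with hbc | hbc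
    · rw [ksign_even hbc]
      exact (Quotient.sound (OpRel.comp_par_even i j j' hlt hj' hi hj hj₁ hi₂ h₁ h h₂ h'
        hab habc hac habc' hbc x y z)).trans (one_zsmul (_ : Obj r k abc)).symm
    · rw [ksign_odd hbc]
      let X : Obj r k abc :=
        Quotient.mk _ (OpTerm.comp j' hj₁ h habc (OpTerm.comp i hi h₁ hab x y) z)
      let Y : Obj r k abc :=
        Quotient.mk _ (OpTerm.comp i hi₂ h' habc' (OpTerm.comp j hj h₂ hac x z) y)
      have e : X = -Y :=
        Quotient.sound (OpRel.comp_par_odd i j j' hlt hj' hi hj hj₁ hi₂ h₁ h h₂ h'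
          hab habc hac habc' hbc x y z)
      exact e.trans (neg_one_zsmul (_ : Obj r k abc)).symm

/-- The class of an expression. -/
def mk {n : ℕ} {a : ℤ} (x : OpTerm G n a) : (operad r).obj n a := Quotient.mk (setoid r n a) x

/-- A generator, as an element of the operad. -/
def gen {n : ℕ} {a : ℤ} (g : G n a) : (operad r).obj n a := mk r (OpTerm.gen g)

/-- The derivation of degree `-1` with prescribed values `δ` on the generators, computed on
expressions. -/
def dTerm (δ : ∀ (n : ℕ) (a : ℤ), G n a → (operad r).obj n (a - 1)) :
    ∀ {n : ℕ} {a : ℤ}, OpTerm G n a → (operad r).obj n (a - 1)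
  | _, _, .gen g => δ _ _ g
  | _, _, .one => 0
  | _, _, .zero => 0
  | _, _, .add x y => dTerm δ x + dTerm δ y
  | _, _, .neg x => -dTerm δ x
  | _, _, .comp (a := a) (b := b) (c := c) i hi hk hc x y =>
      (operad r).comp i hi hk (show a - 1 + b = c - 1 by omega) (dTerm δ x) (mk r y)
        + ksign a • (operad r).comp i hi hk (show a + (b - 1) = c - 1 by omega)
            (mk r x) (dTerm δ y)

section
variable {r}

theorem mk_rel {n : ℕ} {a : ℤ} {x y : OpTerm G n a} (h : OpRel r x y) : mk r x = mk r y :=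
  Quotient.sound h

theorem mk_add {n : ℕ} {a : ℤ} (x y : OpTerm G n a) : mk r (x.add y) = mk r x + mk r y := rfl

theorem mk_neg {n : ℕ} {a : ℤ} (x : OpTerm G n a) : mk r x.neg = -mk r x := rfl

theorem mk_one : mk r OpTerm.one = (operad r).one := rfl

theorem mk_comp {m n k : ℕ} {a b c : ℤ} (i : ℕ) (hi : i < m) (hk : k + 1 = m + n)
    (hc : a + b = c) (x : OpTerm G m a) (y : OpTerm G n b) :
    mk r (OpTerm.comp i hi hk hc x y) = (operad r).comp i hi hk hc (mk r x) (mk r y) := rfl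

variable (δ : ∀ (n : ℕ) (a : ℤ), G n a → (operad r).obj n (a - 1))

theorem dTerm_par {l m n k₁ k₂ k : ℕ} {a b c ab ac abc : ℤ} (i j j' : ℕ) (hlt : i < j)
    (hj' : j' + 1 = j + m) (hi : i < l) (hj : j < l) (hj₁ : j' < k₁) (hi₂ : i < k₂)
    (h₁ : k₁ + 1 = l + m) (h : k + 1 = k₁ + n) (h₂ : k₂ + 1 = l + n) (h' : k + 1 = k₂ + m)
    (hab : a + b = ab) (habc : ab + c = abc) (hac : a + c = ac) (habc' : ac + b = abc)
    (x : OpTerm G l a) (y : OpTerm G m b) (z : OpTerm G n c) :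
    dTerm r δ (OpTerm.comp j' hj₁ h habc (OpTerm.comp i hi h₁ hab x y) z)
      = ksign (b * c) •
        dTerm r δ (OpTerm.comp i hi₂ h' habc' (OpTerm.comp j hj h₂ hac x z) y) := by
  simp only [dTerm, mk_comp, NSOperad.add_comp, NSOperad.zsmul_comp, smul_add]
  rw [NSOperad.comp_par (operad r) i j j' hlt hj' hi hj hj₁ hi₂ h₁ h h₂ h' _ _
      (show a - 1 + c = ac - 1 by omega) (by omega),
    NSOperad.comp_par (operad r) i j j' hlt hj' hi hj hj₁ hi₂ h₁ h h₂ h' _ _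
      hac (by omega),
    NSOperad.comp_par (operad r) i j j' hlt hj' hi hj hj₁ hi₂ h₁ h h₂ h' _ _
      (show a + (c - 1) = ac - 1 by omega) (by omega)]
  have e₁ : ksign ((b - 1) * c) = ksign (b * c) * ksign c := by
    rw [← ksign_add, show b * c + c = (b - 1) * c + (c + c) by ring, ksign_add ((b - 1) * c),
      ksign_even ⟨c, rfl⟩, mul_one]
  have e₂ : ksign (b * (c - 1)) = ksign (b * c) * ksign b := by
    rw [← ksign_add, show b * c + b = b * (c - 1) + (b + b) by ring, ksign_add (b * (c - 1)),
      ksign_even ⟨b, rfl⟩, mul_one]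
  have e₃ : ksign ab = ksign a * ksign b := by rw [← hab, ksign_add]
  have e₄ : ksign ac = ksign a * ksign c := by rw [← hac, ksign_add]
  simp only [smul_smul, e₁, e₂, e₃, e₄]
  rw [show ksign a * ksign b * (ksign (b * c) * ksign b)
      = ksign (b * c) * ksign a * (ksign b * ksign b) by ring, ksign_mul_self, mul_one,
    show ksign a * (ksign (b * c) * ksign c) = ksign (b * c) * (ksign a * ksign c) by ring]
  abel

theorem dTerm_rel
    (hr : ∀ {n : ℕ} {a : ℤ} {x y : OpTerm G n a}, r n a x y → dTerm r δ x = dTerm r δ y)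
    {n : ℕ} {a : ℤ} {x y : OpTerm G n a} (h : OpRel r x y) : dTerm r δ x = dTerm r δ y := by
  induction h with
  | of h => exact hr h
  | refl x => rfl
  | symm _ ih => exact ih.symm
  | trans _ _ ih₁ ih₂ => exact ih₁.trans ih₂
  | add_congr _ _ ih₁ ih₂ => simp only [dTerm, ih₁, ih₂]
  | neg_congr _ ih => simp only [dTerm, ih]
  | comp_congr i hi hk hc h₁ h₂ ih₁ ih₂ => simp only [dTerm, ih₁, ih₂, mk_rel h₁, mk_rel h₂]
  | add_assoc x y z => simp only [dTerm, add_assoc]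
  | add_comm x y => simp only [dTerm, add_comm]
  | zero_add x => simp only [dTerm, zero_add]
  | neg_add x => simp only [dTerm, neg_add_cancel]
  | add_comp i hi hk hc x x' y =>
    simp only [dTerm, mk_add, NSOperad.add_comp, smul_add]; abel
  | comp_add i hi hk hc x y y' =>
    simp only [dTerm, mk_add, NSOperad.comp_add, smul_add]; abel
  | one_comp hk y =>
    simp only [dTerm, mk_one, NSOperad.zero_comp, NSOperad.one_comp, ksign_even Even.zero,
      one_smul, zero_add]
  | comp_one i hi x =>
    simp only [dTerm, mk_one, NSOperad.comp_zero, NSOperad.comp_one, smul_zero, add_zero]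
  | comp_seq i j hi hj hij h₁ h h₂ h' hab habc hbc habc' x y z =>
    rename_i a b c ab bc abc
    simp only [dTerm, mk_comp, NSOperad.add_comp, NSOperad.comp_add, NSOperad.zsmul_comp,
      NSOperad.comp_zsmul, smul_add]
    rw [NSOperad.comp_seq (operad r) i j hi hj hij h₁ h h₂ h' (bc := bc) _ _ hbc (by omega),
      NSOperad.comp_seq (operad r) i j hi hj hij h₁ h h₂ h' (bc := bc - 1) _ _ (by omega) (by omega),
      NSOperad.comp_seq (operad r) i j hi hj hij h₁ h h₂ h' (bc := bc - 1) _ _ (by omega) (by omega),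
      show ksign ab = ksign a * ksign b by rw [← hab, ksign_add], mul_smul, add_assoc]
  | comp_par_even i j j' hlt hj' hi hj hj₁ hi₂ h₁ h h₂ h' hab habc hac habc' hbc x y z =>
    rw [dTerm_par δ i j j' hlt hj' hi hj hj₁ hi₂ h₁ h h₂ h' hab habc hac habc',
      ksign_even hbc, one_smul]
  | comp_par_odd i j j' hlt hj' hi hj hj₁ hi₂ h₁ h h₂ h' hab habc hac habc' hbc x y z =>
    rw [dTerm_par δ i j j' hlt hj' hi hj hj₁ hi₂ h₁ h h₂ h' hab habc hac habc',
      ksign_odd hbc, neg_one_smul]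
    rfl

end

variable (δ : ∀ (n : ℕ) (a : ℤ), G n a → (operad r).obj n (a - 1))
  (hr : ∀ {n : ℕ} {a : ℤ} {x y : OpTerm G n a}, r n a x y → dTerm r δ x = dTerm r δ y)

/-- The derivation of degree `-1` with prescribed values `δ` on the generators. -/
def diff {n : ℕ} {a : ℤ} : (operad r).obj n a →+ (operad r).obj n (a - 1) :=
  AddMonoidHom.mk' (Quotient.lift (dTerm r δ) fun _ _ h => dTerm_rel δ hr h)
    (by rintro ⟨x⟩ ⟨y⟩; rfl)

theorem diff_mk {n : ℕ} {a : ℤ} (x : OpTerm G n a) :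
    diff r δ hr (mk r x) = dTerm r δ x := rfl

theorem diff_comp {m n k : ℕ} {a b c : ℤ} (i : ℕ) (hi : i < m) (hk : k + 1 = m + n)
    (hc : a + b = c) (h₁ : a - 1 + b = c - 1) (h₂ : a + (b - 1) = c - 1)
    (x : (operad r).obj m a) (y : (operad r).obj n b) :
    diff r δ hr ((operad r).comp i hi hk hc x y)
      = (operad r).comp i hi hk h₁ (diff r δ hr x) y
        + ksign a • (operad r).comp i hi hk h₂ x (diff r δ hr y) := by
  rcases x with ⟨x⟩
  rcases y with ⟨y⟩
  rfl

theorem diff_diff (hd : ∀ (n : ℕ) (a : ℤ) (g : G n a), diff r δ hr (δ n a g) = 0)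
    {n : ℕ} {a : ℤ} (x : (operad r).obj n a) : diff r δ hr (diff r δ hr x) = 0 := by
  obtain ⟨x, rfl⟩ := Quotient.exists_rep x
  change diff r δ hr (dTerm r δ x) = 0
  induction x with
  | gen g => exact hd _ _ g
  | one => exact map_zero _
  | zero => exact map_zero _
  | add x y ihx ihy => rw [dTerm, map_add, ihx, ihy, add_zero]
  | neg x ih => rw [dTerm, map_neg, ih, neg_zero]
  | comp i hi hk hc x y ihx ihy =>
    rename_i _ _ _ a b c
    rw [dTerm, map_add, map_zsmul,
      diff_comp r δ hr i hi hk _ (show a - 1 - 1 + b = c - 1 - 1 by omega)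
        (show a - 1 + (b - 1) = c - 1 - 1 by omega),
      diff_comp r δ hr i hi hk _ (show a - 1 + (b - 1) = c - 1 - 1 by omega)
        (show a + (b - 1 - 1) = c - 1 - 1 by omega), ihx, ihy, diff_mk, diff_mk,
      NSOperad.zero_comp, NSOperad.comp_zero, smul_zero, zero_add, add_zero, ksign_sub_one,
      neg_smul, neg_add_cancel]

/-- The dg operad with generators `G`, relations `r`, and the differential which is given by `δ`
on the generators. -/
def dgOperad (hd : ∀ (n : ℕ) (a : ℤ) (g : G n a), diff r δ hr (δ n a g) = 0) : DGOperad where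
  toNSOperad := operad r
  d := diff r δ hr
  d_d := diff_diff r δ hr hd
  d_comp := diff_comp r δ hr

end Presented

/-- The empty set of relations. -/
def noRel (G : ℕ → ℤ → Type) (n : ℕ) (a : ℤ) (_ _ : OpTerm G n a) : Prop := False

/-- The free graded nonsymmetric operad on the generators `G`. -/
abbrev freeOperad (G : ℕ → ℤ → Type) : NSOperad := Presented.operad (noRel G)

/-- The quasi-free dg operad: the free operad on the generators `G`, with the unique differential
extending a given `δ` on the generators (`hd` says that it squares to zero). -/
def quasiFree {G : ℕ → ℤ → Type} (δ : ∀ (n : ℕ) (a : ℤ), G n a → (freeOperad G).obj n (a - 1))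
    (hd : ∀ (n : ℕ) (a : ℤ) (g : G n a),
      Presented.diff (noRel G) δ (fun h => False.elim h) (δ n a g) = 0) : DGOperad :=
  Presented.dgOperad (noRel G) δ (fun h => False.elim h) hd

/-! ### Coproducts of dg operads -/

/-- The relations defining the coproduct of `P` and `Q`: the addition, the unit
and the partial compositions of `P` and of `Q` agree with the formal ones. -/
inductive CoprodRel (P Q : DGOperad) : ∀ (n : ℕ) (a : ℤ),
    OpTerm (fun n a => P.obj n a ⊕ Q.obj n a) n a →
    OpTerm (fun n a => P.obj n a ⊕ Q.obj n a) n a → Prop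
  | inl_add {n : ℕ} {a : ℤ} (x y : P.obj n a) : CoprodRel P Q n a
      (.gen (.inl (x + y))) (.add (.gen (.inl x)) (.gen (.inl y)))
  | inl_one : CoprodRel P Q 1 0 (.gen (.inl P.one)) .one
  | inl_comp {m n k : ℕ} {a b c : ℤ} (i : ℕ) (hi : i < m) (hk : k + 1 = m + n)
      (hc : a + b = c) (x : P.obj m a) (y : P.obj n b) : CoprodRel P Q k c
      (.gen (.inl (P.comp i hi hk hc x y))) (.comp i hi hk hc (.gen (.inl x)) (.gen (.inl y)))
  | inr_add {n : ℕ} {a : ℤ} (x y : Q.obj n a) : CoprodRel P Q n a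
      (.gen (.inr (x + y))) (.add (.gen (.inr x)) (.gen (.inr y)))
  | inr_one : CoprodRel P Q 1 0 (.gen (.inr Q.one)) .one
  | inr_comp {m n k : ℕ} {a b c : ℤ} (i : ℕ) (hi : i < m) (hk : k + 1 = m + n)
      (hc : a + b = c) (x : Q.obj m a) (y : Q.obj n b) : CoprodRel P Q k c
      (.gen (.inr (Q.comp i hi hk hc x y))) (.comp i hi hk hc (.gen (.inr x)) (.gen (.inr y)))

namespace Coprod

variable (P Q : DGOperad)

/-- The differential of the coproduct on the elements of `P` and of `Q`. -/
def δ (n : ℕ) (a : ℤ) :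
    P.obj n a ⊕ Q.obj n a → (Presented.operad (CoprodRel P Q)).obj n (a - 1)
  | .inl x => Presented.gen (CoprodRel P Q) (.inl (P.d x))
  | .inr x => Presented.gen (CoprodRel P Q) (.inr (Q.d x))

/-- The additive inclusion of `P`. -/
def genInl {n : ℕ} {a : ℤ} : P.obj n a →+ (Presented.operad (CoprodRel P Q)).obj n a :=
  AddMonoidHom.mk' (fun x => Presented.gen (CoprodRel P Q) (.inl x))
    fun x y => Presented.mk_rel (.of (.inl_add x y))

/-- The additive inclusion of `Q`. -/
def genInr {n : ℕ} {a : ℤ} : Q.obj n a →+ (Presented.operad (CoprodRel P Q)).obj n a :=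
  AddMonoidHom.mk' (fun x => Presented.gen (CoprodRel P Q) (.inr x))
    fun x y => Presented.mk_rel (.of (.inr_add x y))

theorem genInl_comp {m n k : ℕ} {a b c : ℤ} (i : ℕ) (hi : i < m) (hk : k + 1 = m + n)
    (hc : a + b = c) (x : P.obj m a) (y : P.obj n b) :
    genInl P Q (P.comp i hi hk hc x y)
      = (Presented.operad (CoprodRel P Q)).comp i hi hk hc (genInl P Q x) (genInl P Q y) :=
  Presented.mk_rel (.of (.inl_comp i hi hk hc x y))

theorem genInr_comp {m n k : ℕ} {a b c : ℤ} (i : ℕ) (hi : i < m) (hk : k + 1 = m + n)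
    (hc : a + b = c) (x : Q.obj m a) (y : Q.obj n b) :
    genInr P Q (Q.comp i hi hk hc x y)
      = (Presented.operad (CoprodRel P Q)).comp i hi hk hc (genInr P Q x) (genInr P Q y) :=
  Presented.mk_rel (.of (.inr_comp i hi hk hc x y))

end Coprod

theorem DGOperad.d_one (P : DGOperad) : P.d P.one = 0 := by
  have h := P.d_comp 0 one_pos rfl (zero_add 0) (add_zero _) (zero_add _) P.one P.one
  rw [NSOperad.comp_one, NSOperad.comp_one, NSOperad.one_comp, ksign_even Even.zero,
    one_smul] at h
  simpa using h

namespace Coprod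

variable (P Q : DGOperad)

theorem δ_rel {n : ℕ} {a : ℤ} {x y : OpTerm (fun n a => P.obj n a ⊕ Q.obj n a) n a}
    (h : CoprodRel P Q n a x y) :
    Presented.dTerm (CoprodRel P Q) (δ P Q) x = Presented.dTerm (CoprodRel P Q) (δ P Q) y := by
  cases h with
  | inl_add x y =>
    change genInl P Q (P.d (x + y)) = genInl P Q (P.d x) + genInl P Q (P.d y)
    rw [map_add, map_add]
  | inl_one =>
    change genInl P Q (P.d P.one) = 0
    rw [DGOperad.d_one, map_zero]
  | inl_comp i hi hk hc x y =>
    rename_i a b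
    change genInl P Q (P.d (P.comp i hi hk hc x y))
      = (Presented.operad (CoprodRel P Q)).comp i hi hk _ (genInl P Q (P.d x)) (genInl P Q y)
        + ksign _ • (Presented.operad (CoprodRel P Q)).comp i hi hk _
          (genInl P Q x) (genInl P Q (P.d y))
    rw [P.d_comp i hi hk hc (by omega) (by omega), map_add, map_zsmul, genInl_comp, genInl_comp]
  | inr_add x y =>
    change genInr P Q (Q.d (x + y)) = genInr P Q (Q.d x) + genInr P Q (Q.d y)
    rw [map_add, map_add]
  | inr_one =>
    change genInr P Q (Q.d Q.one) = 0
    rw [DGOperad.d_one, map_zero]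
  | inr_comp i hi hk hc x y =>
    change genInr P Q (Q.d (Q.comp i hi hk hc x y))
      = (Presented.operad (CoprodRel P Q)).comp i hi hk _ (genInr P Q (Q.d x)) (genInr P Q y)
        + ksign _ • (Presented.operad (CoprodRel P Q)).comp i hi hk _
          (genInr P Q x) (genInr P Q (Q.d y))
    rw [Q.d_comp i hi hk hc (by omega) (by omega), map_add, map_zsmul, genInr_comp, genInr_comp]

theorem δ_δ (n : ℕ) (a : ℤ) (g : P.obj n a ⊕ Q.obj n a) :
    Presented.diff (CoprodRel P Q) (δ P Q) (δ_rel P Q) (δ P Q n a g) = 0 := by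
  rcases g with x | x
  · change genInl P Q (P.d (P.d x)) = 0
    rw [P.d_d, map_zero]
  · change genInr P Q (Q.d (Q.d x)) = 0
    rw [Q.d_d, map_zero]

end Coprod

/-- The coproduct `P ∨ Q` of two nonsymmetric dg operads. -/
def DGOperad.coprod (P Q : DGOperad) : DGOperad :=
  Presented.dgOperad (CoprodRel P Q) (Coprod.δ P Q) (Coprod.δ_rel P Q) (Coprod.δ_δ P Q)

/-- The canonical morphism `P ⟶ P ∨ Q`. -/
def DGOperad.coprodInl (P Q : DGOperad) : DGOperad.Hom P (P.coprod Q) where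
  map := Coprod.genInl P Q
  map_one := Presented.mk_rel (.of .inl_one)
  map_comp := Coprod.genInl_comp P Q
  map_d _ := rfl

/-- The canonical morphism `Q ⟶ P ∨ Q`. -/
def DGOperad.coprodInr (P Q : DGOperad) : DGOperad.Hom Q (P.coprod Q) where
  map := Coprod.genInr P Q
  map_one := Presented.mk_rel (.of .inr_one)
  map_comp := Coprod.genInr_comp P Q
  map_d _ := rfl

/-! ### Completion of a filtered dg operad -/

/-- A decreasing filtration of a dg operad by subgroups, multiplicative for the
partial compositions, whose level the differential lowers by at most one. -/
structure DGOperad.Filtration (P : DGOperad) where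
  F : ℕ → ∀ (n : ℕ) (a : ℤ), AddSubgroup (P.obj n a)
  mem_zero : ∀ {n : ℕ} {a : ℤ} (x : P.obj n a), x ∈ F 0 n a
  le_succ : ∀ (t n : ℕ) (a : ℤ), F (t + 1) n a ≤ F t n a
  comp_mem : ∀ {s t m n k : ℕ} {a b c : ℤ} (i : ℕ) (hi : i < m) (hk : k + 1 = m + n)
    (hc : a + b = c) {x : P.obj m a} {y : P.obj n b}, x ∈ F s m a → y ∈ F t n b →
    P.comp i hi hk hc x y ∈ F (s + t) k c
  d_mem : ∀ {t n : ℕ} {a : ℤ} {x : P.obj n a}, x ∈ F (t + 1) n a → P.d x ∈ F t n (a - 1)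

namespace DGOperad.Filtration

variable {P : DGOperad} (Φ : P.Filtration)

theorem antitone {s t n : ℕ} {a : ℤ} (h : s ≤ t) : Φ.F t n a ≤ Φ.F s n a := by
  induction h with
  | refl => exact le_rfl
  | step _ ih => exact (Φ.le_succ _ n a).trans ih

/-- The quotient of level `t` by the filtration. -/
abbrev Quo (t n : ℕ) (a : ℤ) : Type := P.obj n a ⧸ Φ.F t n a

/-- The projection `P / F^{t+1} → P / F^t`. -/
def trans (t n : ℕ) (a : ℤ) : Φ.Quo (t + 1) n a →+ Φ.Quo t n a :=
  QuotientAddGroup.map _ _ (AddMonoidHom.id _) (Φ.le_succ t n a)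

/-- The partial compositions on `P / F^t`. -/
def compQuo (t : ℕ) {m n k : ℕ} {a b c : ℤ} (i : ℕ) (hi : i < m) (hk : k + 1 = m + n)
    (hc : a + b = c) : Φ.Quo t m a → Φ.Quo t n b → Φ.Quo t k c :=
  Quotient.map₂ (P.comp i hi hk hc) fun x x' h y y' h' => by
    rw [← Quotient.eq_iff_equiv] at h h' ⊢
    have e := QuotientAddGroup.eq.1 h
    have e' := QuotientAddGroup.eq.1 h'
    refine QuotientAddGroup.eq.2 ?_
    have e₁ := Φ.comp_mem (s := t) (t := 0) i hi hk hc e (Φ.mem_zero y)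
    have e₂ := Φ.comp_mem (s := 0) (t := t) i hi hk hc (Φ.mem_zero x') e'
    rw [add_zero] at e₁
    rw [zero_add] at e₂
    have e₃ := add_mem e₁ e₂
    rw [NSOperad.add_comp, NSOperad.comp_add, NSOperad.neg_comp, NSOperad.comp_neg] at e₃
    convert e₃ using 1
    abel

/-- The differential `P / F^{t+1} → P / F^t`. -/
def dQuo (t n : ℕ) (a : ℤ) : Φ.Quo (t + 1) n a →+ Φ.Quo t n (a - 1) :=
  QuotientAddGroup.map _ _ P.d fun _ h => Φ.d_mem h

/-- The inverse limit of the quotients `P / F^t`, in each arity and degree. -/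
def limit (n : ℕ) (a : ℤ) : AddSubgroup (∀ t, Φ.Quo t n a) where
  carrier := {x | ∀ t, Φ.trans t n a (x (t + 1)) = x t}
  add_mem' hx hy t := by rw [Pi.add_apply, map_add, hx t, hy t]; rfl
  zero_mem' t := map_zero _
  neg_mem' hx t := by rw [Pi.neg_apply, map_neg, hx t]; rfl

theorem trans_comp (t : ℕ) {m n k : ℕ} {a b c : ℤ} (i : ℕ) (hi : i < m) (hk : k + 1 = m + n)
    (hc : a + b = c) (x : Φ.Quo (t + 1) m a) (y : Φ.Quo (t + 1) n b) :
    Φ.trans t k c (Φ.compQuo (t + 1) i hi hk hc x y)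
      = Φ.compQuo t i hi hk hc (Φ.trans t m a x) (Φ.trans t n b y) := by
  rcases x with ⟨x⟩
  rcases y with ⟨y⟩
  rfl

theorem trans_d (t n : ℕ) (a : ℤ) (x : Φ.Quo (t + 2) n a) :
    Φ.trans t n (a - 1) (Φ.dQuo (t + 1) n a x) = Φ.dQuo t n a (Φ.trans (t + 1) n a x) := by
  rcases x with ⟨x⟩
  rfl

/-- The completion `lim_t P / F^t` of a filtered dg operad, formed in each arity and degree. -/
def completion : DGOperad where
  obj n a := Φ.limit n a
  one := ⟨fun t => (P.one : Φ.Quo t 1 0), fun _ => rfl⟩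
  comp i hi hk hc x y := ⟨fun t => Φ.compQuo t i hi hk hc (x.1 t) (y.1 t), fun t => by
    rw [trans_comp, x.2, y.2]⟩
  add_comp i hi hk hc x x' y := by
    refine Subtype.ext (funext fun t => ?_)
    change Φ.compQuo t i hi hk hc (x.1 t + x'.1 t) (y.1 t)
      = Φ.compQuo t i hi hk hc (x.1 t) (y.1 t) + Φ.compQuo t i hi hk hc (x'.1 t) (y.1 t)
    generalize x.1 t = u, x'.1 t = u', y.1 t = v
    rcases u with ⟨u⟩
    rcases u' with ⟨u'⟩
    rcases v with ⟨v⟩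
    exact congrArg _ (P.add_comp i hi hk hc u u' v)
  comp_add i hi hk hc x y y' := by
    refine Subtype.ext (funext fun t => ?_)
    change Φ.compQuo t i hi hk hc (x.1 t) (y.1 t + y'.1 t)
      = Φ.compQuo t i hi hk hc (x.1 t) (y.1 t) + Φ.compQuo t i hi hk hc (x.1 t) (y'.1 t)
    generalize x.1 t = u, y.1 t = v, y'.1 t = v'
    rcases u with ⟨u⟩
    rcases v with ⟨v⟩
    rcases v' with ⟨v'⟩
    exact congrArg _ (P.comp_add i hi hk hc u v v')
  one_comp hk y := by
    refine Subtype.ext (funext fun t => ?_)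
    change Φ.compQuo t 0 one_pos hk (zero_add _) (P.one : Φ.Quo t 1 0) (y.1 t) = y.1 t
    generalize y.1 t = v
    rcases v with ⟨v⟩
    exact congrArg _ (P.one_comp hk v)
  comp_one i hi x := by
    refine Subtype.ext (funext fun t => ?_)
    change Φ.compQuo t i hi rfl (add_zero _) (x.1 t) (P.one : Φ.Quo t 1 0) = x.1 t
    generalize x.1 t = v
    rcases v with ⟨v⟩
    exact congrArg _ (P.comp_one i hi v)
  comp_seq i j hi hj hij h₁ h h₂ h' hab habc hbc habc' x y z := by
    refine Subtype.ext (funext fun t => ?_)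
    change Φ.compQuo t (i + j) hij h habc (Φ.compQuo t i hi h₁ hab (x.1 t) (y.1 t)) (z.1 t)
      = Φ.compQuo t i hi h' habc' (x.1 t) (Φ.compQuo t j hj h₂ hbc (y.1 t) (z.1 t))
    generalize x.1 t = u, y.1 t = v, z.1 t = w
    rcases u with ⟨u⟩
    rcases v with ⟨v⟩
    rcases w with ⟨w⟩
    exact congrArg _ (P.comp_seq i j hi hj hij h₁ h h₂ h' hab habc hbc habc' u v w)
  comp_par {l m n k₁ k₂ k a b c ab ac abc} i j j' hlt hj' hi hj hj₁ hi₂ h₁ h h₂ h'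
      hab habc hac habc' x y z := by
    refine Subtype.ext (funext fun t => ?_)
    change Φ.compQuo t j' hj₁ h habc (Φ.compQuo t i hi h₁ hab (x.1 t) (y.1 t)) (z.1 t)
      = ksign (b * c) •
        Φ.compQuo t i hi₂ h' habc' (Φ.compQuo t j hj h₂ hac (x.1 t) (z.1 t)) (y.1 t)
    generalize x.1 t = u, y.1 t = v, z.1 t = w
    rcases u with ⟨u⟩
    rcases v with ⟨v⟩
    rcases w with ⟨w⟩
    exact congrArg _
      (P.comp_par i j j' hlt hj' hi hj hj₁ hi₂ h₁ h h₂ h' hab habc hac habc' u v w)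
  d {n a} := AddMonoidHom.mk' (fun x => ⟨fun t => Φ.dQuo t n a (x.1 (t + 1)), fun t => by
      rw [trans_d, x.2]⟩) fun x y => Subtype.ext (funext fun t => map_add (Φ.dQuo t n a) _ _)
  d_d {n a} x := by
    refine Subtype.ext (funext fun t => ?_)
    change Φ.dQuo t n (a - 1) (Φ.dQuo (t + 1) n a (x.1 (t + 2))) = 0
    generalize x.1 (t + 2) = u
    rcases u with ⟨u⟩
    exact congrArg (QuotientAddGroup.mk (s := Φ.F t n (a - 1 - 1))) (P.d_d u)
  d_comp {m n k a b c} i hi hk hc h₁ h₂ x y := by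
    refine Subtype.ext (funext fun t => ?_)
    change Φ.dQuo t k c (Φ.compQuo (t + 1) i hi hk hc (x.1 (t + 1)) (y.1 (t + 1)))
      = Φ.compQuo t i hi hk h₁ (Φ.dQuo t m a (x.1 (t + 1))) (y.1 t)
        + ksign a • Φ.compQuo t i hi hk h₂ (x.1 t) (Φ.dQuo t n b (y.1 (t + 1)))
    rw [← x.2 t, ← y.2 t]
    generalize x.1 (t + 1) = u, y.1 (t + 1) = v
    rcases u with ⟨u⟩
    rcases v with ⟨v⟩
    exact congrArg _ (P.d_comp i hi hk hc h₁ h₂ u v)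

/-- The canonical morphism from a filtered dg operad to its completion. -/
def toCompletion : DGOperad.Hom P Φ.completion where
  map {n a} := AddMonoidHom.mk' (fun x => ⟨fun t => (x : Φ.Quo t n a), fun _ => rfl⟩)
    fun _ _ => rfl
  map_one := rfl
  map_comp _ _ _ _ _ _ := rfl
  map_d _ := rfl

/-- The sum in the completion of the series `∑ x t`, where `x t` lies in `F^t`:
its class modulo `F^t` is the class of the partial sum `x 0 + ⋯ + x (t - 1)`. -/
def series {n : ℕ} {a : ℤ} (x : ℕ → P.obj n a) (hx : ∀ t, x t ∈ Φ.F t n a) :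
    Φ.completion.obj n a :=
  ⟨fun t => ((∑ s ∈ Finset.range t, x s : P.obj n a) : Φ.Quo t n a), fun t => by
    change ((∑ s ∈ Finset.range (t + 1), x s : P.obj n a) : Φ.Quo t n a) = _
    rw [Finset.sum_range_succ, QuotientAddGroup.mk_add,
      (QuotientAddGroup.eq_zero_iff (x t)).2 (hx t), add_zero]⟩

end DGOperad.Filtration

/-! ### The operad `T`, and completed coproducts with it -/

/-- The generators of `T`: `α` of arity `0` and degree `0`, `κ` of arity `0` and degree `-1`. -/
inductive TGen : ℕ → ℤ → Type
  | alpha : TGen 0 0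
  | kappa : TGen 0 (-1)

/-- The differential of `T` on the generators: `d α = κ` and `d κ = 0`. -/
def TGen.δ : ∀ (n : ℕ) (a : ℤ), TGen n a → (freeOperad TGen).obj n (a - 1)
  | _, _, .alpha => Presented.gen (noRel TGen) TGen.kappa
  | _, _, .kappa => 0

/-- The dg operad `T`, freely generated by `α` and `κ`, with `d α = κ` and `d κ = 0`. -/
def opT : DGOperad :=
  quasiFree TGen.δ (by rintro _ _ (_ | _) <;> rfl)

/-- The generator `α` of `T`. -/
def opT.alpha : opT.obj 0 0 := Presented.gen (noRel TGen) TGen.alpha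

/-- The generator `κ` of `T`. -/
def opT.kappa : opT.obj 0 (-1) := Presented.gen (noRel TGen) TGen.kappa

/-- `HasCount e t x`: the operation `x` lies in the subgroup spanned by the composites
in which the operation `e` is used at least `t` times. -/
inductive HasCount {P : DGOperad} {m₀ : ℕ} {a₀ : ℤ} (e : P.obj m₀ a₀) :
    ℕ → ∀ {n : ℕ} {a : ℤ}, P.obj n a → Prop
  | any {n : ℕ} {a : ℤ} (x : P.obj n a) : HasCount e 0 x
  | self : HasCount e 1 e
  | weaken {t n : ℕ} {a : ℤ} {x : P.obj n a} : HasCount e (t + 1) x → HasCount e t x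
  | zero (t n : ℕ) (a : ℤ) : HasCount e t (0 : P.obj n a)
  | add {t n : ℕ} {a : ℤ} {x y : P.obj n a} :
      HasCount e t x → HasCount e t y → HasCount e t (x + y)
  | neg {t n : ℕ} {a : ℤ} {x : P.obj n a} : HasCount e t x → HasCount e t (-x)
  | comp {s t m n k : ℕ} {a b c : ℤ} (i : ℕ) (hi : i < m) (hk : k + 1 = m + n)
      (hc : a + b = c) {x : P.obj m a} {y : P.obj n b} :
      HasCount e s x → HasCount e t y → HasCount e (s + t) (P.comp i hi hk hc x y)

theorem HasCount.mono {P : DGOperad} {m₀ : ℕ} {a₀ : ℤ} {e : P.obj m₀ a₀} {s t n : ℕ} {a : ℤ}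
    {x : P.obj n a} (h : HasCount e t x) (hst : s ≤ t) : HasCount e s x := by
  induction hst with
  | refl => exact h
  | step _ ih => exact ih h.weaken

theorem HasCount.zsmul {P : DGOperad} {m₀ : ℕ} {a₀ : ℤ} {e : P.obj m₀ a₀} {t n : ℕ} {a : ℤ}
    {x : P.obj n a} (h : HasCount e t x) (z : ℤ) : HasCount e t (z • x) :=
  AddSubgroup.zsmul_mem
    { carrier := {x : P.obj n a | HasCount e t x}
      add_mem' := HasCount.add
      zero_mem' := HasCount.zero t n a
      neg_mem' := HasCount.neg } h z

theorem HasCount.d {P : DGOperad} {m₀ : ℕ} {a₀ : ℤ} {e : P.obj m₀ a₀} {t n : ℕ} {a : ℤ}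
    {x : P.obj n a} (h : HasCount e t x) : HasCount e (t - 1) (P.d x) := by
  induction h with
  | any x => exact .any _
  | self => exact .any _
  | weaken _ ih => exact ih.mono (by omega)
  | zero => rw [map_zero]; exact .zero _ _ _
  | add _ _ ih₁ ih₂ => rw [map_add]; exact ih₁.add ih₂
  | neg _ ih => rw [map_neg]; exact ih.neg
  | comp i hi hk hc hx hy ih₁ ih₂ =>
    rw [P.d_comp i hi hk hc (by omega) (by omega)]
    exact ((HasCount.comp i hi hk _ ih₁ hy).mono (by omega)).add
      (((HasCount.comp i hi hk _ hx ih₂).mono (by omega)).zsmul _)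

/-- The filtration of a dg operad by the number of occurrences of the operation `e`. -/
def DGOperad.countFiltration (P : DGOperad) {m₀ : ℕ} {a₀ : ℤ} (e : P.obj m₀ a₀) :
    P.Filtration where
  F t n a :=
    { carrier := {x | HasCount e t x}
      add_mem' := HasCount.add
      zero_mem' := HasCount.zero t n a
      neg_mem' := HasCount.neg }
  mem_zero x := HasCount.any x
  le_succ _ _ _ _ h := HasCount.weaken h
  comp_mem i hi hk hc _ _ h h' := HasCount.comp i hi hk hc h h'
  d_mem h := HasCount.d h

/-- The element `α` of `P ∨ T`. -/
def alphaIn (P : DGOperad) : (P.coprod opT).obj 0 0 := (P.coprodInr opT).map opT.alpha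

/-- The element `κ` of `P ∨ T`. -/
def kappaIn (P : DGOperad) : (P.coprod opT).obj 0 (-1) := (P.coprodInr opT).map opT.kappa

/-- The filtration of `P ∨ T` by the number of `α`. -/
def alphaFiltration (P : DGOperad) : (P.coprod opT).Filtration :=
  (P.coprod opT).countFiltration (alphaIn P)

/-- The completed coproduct of `P` and `T`: the completion of the coproduct
`P ∨ T` with respect to the filtration by the number of `α`. -/
def completedCoprodT (P : DGOperad) : DGOperad := (alphaFiltration P).completion

/-- The canonical morphism from the coproduct of `P` and `T` to the completed one. -/
def toCompletedCoprodT (P : DGOperad) : DGOperad.Hom (P.coprod opT) (completedCoprodT P) :=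
  (alphaFiltration P).toCompletion

/-! ### The curved `A∞` operad -/

/-- The triples of natural numbers `(p, q, r)` with `p + q + r = n`. -/
@[ext]
structure Split (n : ℕ) where
  p : ℕ
  q : ℕ
  r : ℕ
  sum_eq : p + q + r = n

noncomputable instance (n : ℕ) : Fintype (Split n) :=
  Fintype.ofInjective
    (fun s : Split n => ((⟨s.p, by have := s.sum_eq; omega⟩, ⟨s.q, by have := s.sum_eq; omega⟩,
      ⟨s.r, by have := s.sum_eq; omega⟩) : Fin (n + 1) × Fin (n + 1) × Fin (n + 1)))
    fun s t h => by
      simp only [Prod.mk.injEq, Fin.mk.injEq] at h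
      exact Split.ext h.1 h.2.1 h.2.2

/-- The sum `∑_{p + q + r = n} μ_{p+1+r} ∘_{p+1} μ_q` of the partial compositions
of operations `μ` of degree `-1`. -/
noncomputable def NSOperad.selfComp (P : NSOperad) (μ : ∀ n : ℕ, P.obj n (-1)) (n : ℕ) :
    P.obj n (-1 - 1) :=
  ∑ s : Split n, P.comp s.p (by omega) (by have := s.sum_eq; omega) (by norm_num)
    (μ (s.p + 1 + s.r)) (μ s.q)

/-- The generators of the curved `A∞` operad: `μ n` of arity `n` and degree `-1`, for `n ≥ 0`. -/
inductive AGen : ℕ → ℤ → Type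
  | mu (n : ℕ) : AGen n (-1)

/-- The differential on the generators:
`d μ_n = -∑_{p + q + r = n} μ_{p+1+r} ∘_{p+1} μ_q`. -/
noncomputable def AGen.δ : ∀ (n : ℕ) (a : ℤ), AGen n a → (freeOperad AGen).obj n (a - 1)
  | _, _, .mu n => -(freeOperad AGen).selfComp (fun n => Presented.gen (noRel AGen) (AGen.mu n)) n

theorem Split.sigma_ext {n : ℕ} {g : Split n → ℕ} {x y : Σ s : Split n, Split (g s)}
    (h₁ : x.1.p = y.1.p) (h₂ : x.1.q = y.1.q) (h₃ : x.2.p = y.2.p) (h₄ : x.2.q = y.2.q) :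
    x = y := by
  obtain ⟨⟨p, q, r, h⟩, ⟨p', q', r', h'⟩⟩ := x
  obtain ⟨⟨s, t, u, k⟩, ⟨s', t', u', k'⟩⟩ := y
  simp only at h₁ h₂ h₃ h₄
  subst h₁ h₂ h₃ h₄
  obtain rfl : r = u := by omega
  obtain rfl : r' = u' := by omega
  rfl

section
variable (P : NSOperad) (μ : ∀ n : ℕ, P.obj n (-1))

theorem NSOperad.mu_seq {l l' m m' n n' k₁ k₂ k i i' j t : ℕ} (el : l = l') (em : m = m')
    (en : n = n') (ei : i = i') (et : t = i + j)
    (hi : i < l) (hi' : i' < l') (hj : j < m') (ht : t < k₁)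
    (h₁ : k₁ + 1 = l + m) (h : k + 1 = k₁ + n) (h₂ : k₂ + 1 = m' + n') (h' : k + 1 = l' + k₂)
    (hd : (-1 : ℤ) + -1 = -1 - 1) (hd' : (-1 - 1 : ℤ) + -1 = -1 - 1 - 1)
    (hd'' : (-1 : ℤ) + (-1 - 1) = -1 - 1 - 1) :
    P.comp t ht h hd' (P.comp i hi h₁ hd (μ l) (μ m)) (μ n)
      = P.comp i' hi' h' hd'' (μ l') (P.comp j hj h₂ hd (μ m') (μ n')) := by
  subst el em en ei et
  exact P.comp_seq i j hi hj ht h₁ h h₂ h' _ _ _ _ _ _ _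

theorem NSOperad.mu_par {l l' m m' n n' k₁ k₂ k i i' j j' : ℕ} (el : l = l') (em : m = m')
    (en : n = n') (ei : i = i') (hlt : i < j) (hj' : j' + 1 = j + m)
    (hi : i < l) (hj : j < l') (hj₁ : j' < k₁) (hi₂ : i' < k₂)
    (h₁ : k₁ + 1 = l + m) (h : k + 1 = k₁ + n) (h₂ : k₂ + 1 = l' + n') (h' : k + 1 = k₂ + m')
    (hd : (-1 : ℤ) + -1 = -1 - 1) (hd' : (-1 - 1 : ℤ) + -1 = -1 - 1 - 1) :
    P.comp j' hj₁ h hd' (P.comp i hi h₁ hd (μ l) (μ m)) (μ n)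
      = -P.comp i' hi₂ h' hd' (P.comp j hj h₂ hd (μ l') (μ n')) (μ m') := by
  subst el em en ei
  rw [P.comp_par i j j' hlt hj' hi hj hj₁ hi₂ h₁ h h₂ h' hd hd' hd hd',
    ksign_odd (by decide), neg_one_smul]

theorem NSOperad.selfComp_selfComp (n : ℕ) :
    ∑ s : Split n, P.comp (k := n) s.p (by omega) (by have := s.sum_eq; omega)
        (show (-1 - 1 : ℤ) + -1 = -1 - 1 - 1 by norm_num)
        (P.selfComp μ (s.p + 1 + s.r)) (μ s.q)
      = ∑ s : Split n, P.comp (k := n) s.p (by omega) (by have := s.sum_eq; omega)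
        (show (-1 : ℤ) + (-1 - 1) = -1 - 1 - 1 by norm_num)
        (μ (s.p + 1 + s.r)) (P.selfComp μ s.q) := by
  classical
  simp only [NSOperad.selfComp, NSOperad.sum_comp, NSOperad.comp_sum]
  rw [← Fintype.sum_sigma', ← Fintype.sum_sigma']
  rw [← Finset.sum_filter_add_sum_filter_not _
    (fun x : Σ s : Split n, Split (s.p + 1 + s.r) => x.2.p ≤ x.1.p ∧ x.1.p < x.2.p + x.2.q)]
  have key : ∑ x : Σ s : Split n, Split (s.p + 1 + s.r) with
      ¬ (x.2.p ≤ x.1.p ∧ x.1.p < x.2.p + x.2.q),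
      P.comp (m := x.1.p + 1 + x.1.r) (k := n) x.1.p (by omega) (by have := x.1.sum_eq; omega)
        (show (-1 - 1 : ℤ) + -1 = -1 - 1 - 1 by norm_num)
        (P.comp x.2.p (by omega) (by have := x.2.sum_eq; omega) (by norm_num)
          (μ (x.2.p + 1 + x.2.r)) (μ x.2.q)) (μ x.1.q) = (0 : P.obj n (-1 - 1 - 1)) := by
    rw [← Finset.sum_filter_add_sum_filter_not _
      (fun x : Σ s : Split n, Split (s.p + 1 + s.r) => x.2.p ≤ x.1.p), Finset.filter_filter,
      Finset.filter_filter, add_eq_zero_iff_eq_neg, ← Finset.sum_neg_distrib]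
    refine Finset.sum_bij'
      (fun x hx => ⟨⟨x.2.p, x.2.q, n - x.2.p - x.2.q, ?_⟩,
        ⟨x.1.p - x.2.q + 1, x.1.q, x.2.p + x.2.r - 1 - (x.1.p - x.2.q), ?_⟩⟩)
      (fun x hx => ⟨⟨x.2.p - 1 + x.1.q, x.2.q, n - (x.2.p - 1 + x.1.q) - x.2.q, ?_⟩,
        ⟨x.1.p, x.1.q, x.2.p + x.2.r - x.1.p, ?_⟩⟩) ?_ ?_ ?_ ?_ ?_
    case refine_9 =>
      rintro ⟨⟨p, q, r, h⟩, ⟨s, t, u, k⟩⟩ hx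
      simp only [Finset.mem_filter, Finset.mem_univ, true_and] at hx h k
      exact P.mu_par μ (by dsimp only; omega) rfl rfl rfl (by dsimp only; omega)
        (by dsimp only; omega) _ _ _ _ _ _ _ _ _ _
    case refine_7 =>
      rintro ⟨⟨p, q, r, h⟩, ⟨s, t, u, k⟩⟩ hx
      simp only [Finset.mem_filter, Finset.mem_univ, true_and] at hx h k
      refine Split.sigma_ext ?_ ?_ ?_ ?_ <;> dsimp only <;> omega
    case refine_8 =>
      rintro ⟨⟨p, q, r, h⟩, ⟨s, t, u, k⟩⟩ hx
      simp only [Finset.mem_filter, Finset.mem_univ, true_and] at hx h k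
      refine Split.sigma_ext ?_ ?_ ?_ ?_ <;> dsimp only <;> omega
    case refine_5 =>
      rintro ⟨⟨p, q, r, h⟩, ⟨s, t, u, k⟩⟩ hx
      simp only [Finset.mem_filter, Finset.mem_univ, true_and] at hx h k ⊢
      omega
    case refine_6 =>
      rintro ⟨⟨p, q, r, h⟩, ⟨s, t, u, k⟩⟩ hx
      simp only [Finset.mem_filter, Finset.mem_univ, true_and] at hx h k ⊢
      omega
    all_goals
      have h := x.1.sum_eq
      have k := x.2.sum_eq
      simp only [Finset.mem_filter, Finset.mem_univ, true_and] at hx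
      try dsimp only
      omega
  rw [key, add_zero]
  refine Finset.sum_bij'
    (fun x hx => ⟨⟨x.2.p, x.2.q + x.1.q - 1, x.2.r, ?_⟩, ⟨x.1.p - x.2.p, x.1.q,
      x.2.q - 1 - (x.1.p - x.2.p), ?_⟩⟩)
    (fun y _ => ⟨⟨y.1.p + y.2.p, y.2.q, y.2.r + y.1.r, ?_⟩,
      ⟨y.1.p, y.2.p + 1 + y.2.r, y.1.r, ?_⟩⟩) ?_ ?_ ?_ ?_ ?_
  case refine_9 =>
    rintro ⟨⟨p, q, r, h⟩, ⟨s, t, u, k⟩⟩ hx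
    simp only [Finset.mem_filter, Finset.mem_univ, true_and] at hx h k
    exact P.mu_seq μ rfl (by dsimp only; omega) rfl rfl (by dsimp only; omega) _ _ _ _ _ _ _ _ _ _ _
  case refine_7 =>
    rintro ⟨⟨p, q, r, h⟩, ⟨s, t, u, k⟩⟩ hx
    simp only [Finset.mem_filter, Finset.mem_univ, true_and] at hx h k
    refine Split.sigma_ext ?_ ?_ ?_ ?_ <;> dsimp only <;> omega
  case refine_8 =>
    rintro ⟨⟨p, q, r, h⟩, ⟨s, t, u, k⟩⟩ hx
    simp only [Finset.mem_univ] at hx h k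
    refine Split.sigma_ext ?_ ?_ ?_ ?_ <;> dsimp only <;> omega
  case refine_5 =>
    rintro ⟨⟨p, q, r, h⟩, ⟨s, t, u, k⟩⟩ hx
    exact Finset.mem_univ _
  case refine_6 =>
    rintro ⟨⟨p, q, r, h⟩, ⟨s, t, u, k⟩⟩ hx
    simp only [Finset.mem_filter, Finset.mem_univ, true_and] at hx h k ⊢
    omega
  case refine_1 | refine_2 =>
    have h := x.1.sum_eq
    have k := x.2.sum_eq
    simp only [Finset.mem_filter, Finset.mem_univ, true_and] at hx
    try dsimp only
    omega
  case refine_3 | refine_4 =>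
    have h := y.1.sum_eq
    have k := y.2.sum_eq
    try dsimp only
    omega

end

theorem AGen.δ_δ (n : ℕ) (a : ℤ) (g : AGen n a) :
    Presented.diff (noRel AGen) AGen.δ (fun h => False.elim h) (AGen.δ n a g) = 0 := by
  rcases g with ⟨n⟩
  have e : ∀ n, Presented.diff (noRel AGen) AGen.δ (fun h => False.elim h)
      (Presented.gen (noRel AGen) (AGen.mu n))
      = -(freeOperad AGen).selfComp (fun n => Presented.gen (noRel AGen) (AGen.mu n)) n :=
    fun _ => rfl
  rw [AGen.δ, map_neg, NSOperad.selfComp, map_sum]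
  simp only [freeOperad] at e ⊢
  rw [Finset.sum_congr rfl fun s _ => Presented.diff_comp (noRel AGen) AGen.δ
    (fun h => False.elim h) _ _ _ _ (show (-1 - 1 : ℤ) + -1 = -1 - 1 - 1 by norm_num)
    (show (-1 : ℤ) + (-1 - 1) = -1 - 1 - 1 by norm_num) _ _]
  simp only [e, NSOperad.neg_comp, NSOperad.comp_neg, ksign_odd (show Odd (-1 : ℤ) by decide),
    neg_one_smul, neg_neg, Finset.sum_add_distrib, Finset.sum_neg_distrib]
  rw [NSOperad.selfComp_selfComp]
  simp

/-- The curved `A∞` operad: the free operad on generators `μ n` of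
arity `n` and degree `-1`, `n ≥ 0`, with differential
`d μ_n = -∑_{p + q + r = n} μ_{p+1+r} ∘_{p+1} μ_q`. -/
noncomputable def cAinf : DGOperad := quasiFree AGen.δ AGen.δ_δ

/-- The generator `μ_n` of the curved `A∞` operad. -/
def cAinf.mu (n : ℕ) : cAinf.obj n (-1) := Presented.gen (noRel AGen) (AGen.mu n)

/-! ### The twisting formula -/

/-- `P.plug w _ _ x` inserts operations of arity `0` and degree `0` into some
of the last `w.length` inputs of `x`, as described by the word `w`: a letter `some y` stands for
an input that receives `y`, and the letter `none` for an input that stays open. The first `s`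
inputs are left open as well. For `s = 0` and `w = [some y, none, some z]`, it is `x(y, -, z)`. -/
def NSOperad.plug (P : NSOperad) {a : ℤ} : ∀ (w : List (Option (P.obj 0 0))) {s m k : ℕ},
    m = s + w.length → k = s + w.countP Option.isNone → P.obj m a → P.obj k a
  | [], _, _, _, hm, hk, x => (show _ = _ from hm.trans hk.symm) ▸ x
  | none :: w, s, _, _, hm, hk, x => P.plug w (s := s + 1)
      (by rw [hm, List.length_cons]; omega)
      (by rw [hk, List.countP_cons]; simp; omega) x
  | some y :: w, s, m, _, hm, hk, x => P.plug w (s := s) (m := m - 1)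
      (by rw [hm, List.length_cons]; omega)
      (by rw [hk, List.countP_cons]; simp)
      (P.comp s (by rw [hm, List.length_cons]; omega)
        (by rw [List.length_cons] at hm; omega) (add_zero a) x y)

/-- The word `y^{i 0}, -, y^{i 1}, -, …, -, y^{i n}`, with `n` open inputs. -/
def insertWord {Y : Type} (y : Y) : ∀ {n : ℕ}, (Fin (n + 1) → ℕ) → List (Option Y)
  | 0, i => List.replicate (i 0) (some y)
  | _ + 1, i => List.replicate (i 0) (some y) ++ none :: insertWord y (Fin.tail i)

theorem insertWord_length {Y : Type} (y : Y) : ∀ {n : ℕ} (i : Fin (n + 1) → ℕ),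
    (insertWord y i).length = n + ∑ t, i t
  | 0, i => by simp [insertWord]
  | n + 1, i => by
    rw [insertWord, List.length_append, List.length_cons, insertWord_length,
      Fin.sum_univ_succ i, List.length_replicate]
    simp only [Fin.tail]
    omega

theorem insertWord_countP {Y : Type} (y : Y) : ∀ {n : ℕ} (i : Fin (n + 1) → ℕ),
    (insertWord y i).countP Option.isNone = n
  | 0, i => by simp [insertWord, List.countP_replicate]
  | n + 1, i => by
    rw [insertWord, List.countP_append, List.countP_cons, insertWord_countP]
    simp [List.countP_replicate]

theorem HasCount.plug {P : DGOperad} (e : P.obj 0 0) {a : ℤ} :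
    ∀ (w : List (Option (P.obj 0 0))) (_ : ∀ y, some y ∈ w → y = e) {t s m k : ℕ}
      (hm : m = s + w.length) (hk : k = s + w.countP Option.isNone) (x : P.obj m a),
      HasCount e t x → HasCount e (t + w.countP Option.isSome) (P.plug w hm hk x) := by
  intro w
  induction w with
  | nil =>
    intro _ t s m k hm hk x hx
    have e' : m = k := hm.trans hk.symm
    subst e'
    exact hx
  | cons c w ih =>
    intro hw t s m k hm hk x hx
    rcases c with _ | y
    · simpa [NSOperad.plug] using
        ih (fun y hy => hw y (List.mem_cons_of_mem _ hy)) (s := s + 1) _ _ x hx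
    · obtain rfl := hw y List.mem_cons_self
      rw [NSOperad.plug, List.countP_cons]
      exact (ih (fun y hy => hw y (List.mem_cons_of_mem _ hy)) _ _ _
        (HasCount.comp s _ _ _ hx .self)).mono (by simp; omega)

theorem insertWord_mem {Y : Type} (y : Y) : ∀ {n : ℕ} (i : Fin (n + 1) → ℕ) (z : Y),
    some z ∈ insertWord y i → z = y
  | 0, i, z, h => by simp [insertWord] at h; exact h.2
  | n + 1, i, z, h => by
    rw [insertWord, List.mem_append, List.mem_cons] at h
    rcases h with h | h | h
    · simp at h; exact h.2
    · cases h
    · exact insertWord_mem y _ z h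

theorem insertWord_countP_isSome {Y : Type} (y : Y) : ∀ {n : ℕ} (i : Fin (n + 1) → ℕ),
    (insertWord y i).countP Option.isSome = ∑ t, i t
  | 0, i => by simp [insertWord, List.countP_replicate]
  | n + 1, i => by
    rw [insertWord, List.countP_append, List.countP_cons, insertWord_countP_isSome,
      Fin.sum_univ_succ i]
    simp [List.countP_replicate, Fin.tail]

/-- The operation `μ_{n + i 0 + ⋯ + i n}(α^{i 0}, -, α^{i 1}, -, …, -, α^{i n})` of
`cA∞ ∨ T`, of arity `n`. -/
noncomputable def muAlpha {n : ℕ} (i : Fin (n + 1) → ℕ) : (cAinf.coprod opT).obj n (-1) :=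
  (cAinf.coprod opT).plug (insertWord (alphaIn cAinf) i) (s := 0)
    ((insertWord_length _ i).symm.trans (zero_add _).symm)
    ((insertWord_countP _ i).symm.trans (zero_add _).symm)
    ((cAinf.coprodInl opT).map (cAinf.mu (n + ∑ t, i t)))

theorem muAlpha_mem {n : ℕ} (i : Fin (n + 1) → ℕ) :
    muAlpha i ∈ (alphaFiltration cAinf).F (∑ t, i t) n (-1) := by
  have h := HasCount.plug (alphaIn cAinf) (insertWord (alphaIn cAinf) i)
    (insertWord_mem _ i) (t := 0) (s := 0)
    ((insertWord_length _ i).symm.trans (zero_add _).symm)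
    ((insertWord_countP _ i).symm.trans (zero_add _).symm)
    ((cAinf.coprodInl opT).map (cAinf.mu (n + ∑ t, i t))) (.any _)
  rw [insertWord_countP_isSome, zero_add] at h
  exact h

/-- The infinite sum `∑ μ_{n + i 0 + ⋯ + i n}(α^{i 0}, -, α^{i 1}, -, …, -, α^{i n})` over all
`i 0, …, i n ≥ 0` in the completed coproduct of `cA∞` and `T`, grouped by the total
number `t = i 0 + ⋯ + i n` of insertions. -/
noncomputable def muSeries (n : ℕ) : (completedCoprodT cAinf).obj n (-1) :=
  (alphaFiltration cAinf).series
    (fun t => ∑ i ∈ Finset.Nat.antidiagonalTuple (n + 1) t, muAlpha i)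
    (fun t => sum_mem fun i hi => by
      have h := muAlpha_mem i
      rwa [Finset.Nat.mem_antidiagonalTuple.1 hi] at h)

/-- The prescribed images of the generators: `κ + ∑_k μ_k(α, …, α)` for `μ_0`, and
`∑ μ_{n + i 0 + ⋯ + i n}(α^{i 0}, -, α^{i 1}, -, …, -, α^{i n})` for `μ_n` with `n ≥ 1`. -/
noncomputable def twistedMu : ∀ n : ℕ, (completedCoprodT cAinf).obj n (-1)
  | 0 => (toCompletedCoprodT cAinf).map (kappaIn cAinf) + muSeries 0
  | n + 1 => muSeries (n + 1)

/-! Since the graded operad underlying `cAinf` is free, a morphism out of it is the same as a family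
`ν n` with `d (ν n) = -selfComp ν n`. Everything therefore reduces to verifying this equation for
the twisted operations.

Describe an insertion pattern by a word with a letter `some ()` for each input that receives `α` and
a letter `none` for each open one. The twisted operation of arity `n` is then the sum over all words
with `n` letters `none`, plus `κ` if `n = 0`. As `α` has degree `0`, insertions produce no signs.
The differential of a summand has two kinds of terms. Those from `d μ` are insertions into a
composite of two `μ`'s; the word is cut into three pieces `w₁`, `w₂`, `w₃`, and the term is the
composite of `μ` with insertions `w₁, none, w₃` and `μ` with insertions `w₂`
(`NSOperad.ins_comp_mu`). Those from `d α = κ` replace one `α` by `κ`, which cuts the word into a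
pair (`DGOperad.d_ins`).

The quadratic expression in the twisted operations is indexed in the same way. A word of the outer
factor is cut uniquely at the open input that receives the inner factor, so the products of two
insertions are indexed by triples (`NSOperad.sum_split_comp_twistSum`). The products with `κ` inside
are indexed by pairs (`NSOperad.sum_split_comp_inZero`), and `κ` is never the outer factor because
it has no inputs. Triples cancel against triples and pairs against pairs, while `d κ = d (d α) = 0`.

The completion adds only bookkeeping. Turning an `α` into `κ` loses one `α`, so the differential
modulo `F^t` needs words with at most `t` insertions, whereas the composition needs fewer than `t`
in each factor. The pair sums then agree exactly, and the triples in only one of the two truncations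
lie in `F^t` (`DGOperad.d_twist_add_selfComp_mem`). -/

/-! ### Morphisms out of free and quasi-free operads -/

namespace Presented

variable {G : ℕ → ℤ → Type} (Q : NSOperad) (φ : ∀ {n : ℕ} {a : ℤ}, G n a → Q.obj n a)

/-- The value of an operadic expression in an operad `Q`, given the values `φ` of the
generators. -/
def exprValue : ∀ {n : ℕ} {a : ℤ}, OpTerm G n a → Q.obj n a
  | _, _, .gen g => φ g
  | _, _, .one => Q.one
  | _, _, .zero => 0
  | _, _, .add x y => exprValue x + exprValue y
  | _, _, .neg x => -exprValue x
  | _, _, .comp i hi hk hc x y => Q.comp i hi hk hc (exprValue x) (exprValue y)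

theorem exprValue_rel {n : ℕ} {a : ℤ} {x y : OpTerm G n a} (h : OpRel (noRel G) x y) :
    exprValue Q φ x = exprValue Q φ y := by
  induction h with
  | of h => exact h.elim
  | refl x => rfl
  | symm _ ih => exact ih.symm
  | trans _ _ ih₁ ih₂ => exact ih₁.trans ih₂
  | add_congr _ _ ih₁ ih₂ => simp only [exprValue, ih₁, ih₂]
  | neg_congr _ ih => simp only [exprValue, ih]
  | comp_congr i hi hk hc h₁ h₂ ih₁ ih₂ => simp only [exprValue, ih₁, ih₂]
  | add_assoc x y z => simp only [exprValue, add_assoc]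
  | add_comm x y => simp only [exprValue, add_comm]
  | zero_add x => simp only [exprValue, zero_add]
  | neg_add x => simp only [exprValue, neg_add_cancel]
  | add_comp i hi hk hc x x' y => exact Q.add_comp i hi hk hc _ _ _
  | comp_add i hi hk hc x y y' => exact Q.comp_add i hi hk hc _ _ _
  | one_comp hk y => exact Q.one_comp hk _
  | comp_one i hi x => exact Q.comp_one i hi _
  | comp_seq i j hi hj hij h₁ h h₂ h' hab habc hbc habc' x y z =>
    exact Q.comp_seq i j hi hj hij h₁ h h₂ h' hab habc hbc habc' _ _ _
  | comp_par_even i j j' hlt hj' hi hj hj₁ hi₂ h₁ h h₂ h' hab habc hac habc' hbc x y z =>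
    refine (Q.comp_par i j j' hlt hj' hi hj hj₁ hi₂ h₁ h h₂ h' hab habc hac habc' _ _ _).trans ?_
    rw [ksign_even hbc, one_smul]
    rfl
  | comp_par_odd i j j' hlt hj' hi hj hj₁ hi₂ h₁ h h₂ h' hab habc hac habc' hbc x y z =>
    refine (Q.comp_par i j j' hlt hj' hi hj hj₁ hi₂ h₁ h h₂ h' hab habc hac habc' _ _ _).trans ?_
    rw [ksign_odd hbc, neg_one_smul]
    rfl

/-- The morphism of graded operads from a free operad extending `φ`. -/
def freeLift {n : ℕ} {a : ℤ} : (freeOperad G).obj n a →+ Q.obj n a :=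
  AddMonoidHom.mk' (Quotient.lift (exprValue Q φ) fun _ _ h => exprValue_rel Q φ h)
    (by rintro ⟨x⟩ ⟨y⟩; rfl)

theorem freeLift_gen {n : ℕ} {a : ℤ} (g : G n a) :
    freeLift Q φ (gen (noRel G) g) = φ g := rfl

theorem freeLift_comp {m n k : ℕ} {a b c : ℤ} (i : ℕ) (hi : i < m) (hk : k + 1 = m + n)
    (hc : a + b = c) (x : (freeOperad G).obj m a) (y : (freeOperad G).obj n b) :
    freeLift Q φ ((freeOperad G).comp i hi hk hc x y)
      = Q.comp i hi hk hc (freeLift Q φ x) (freeLift Q φ y) := by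
  rcases x with ⟨x⟩
  rcases y with ⟨y⟩
  rfl

end Presented

section
variable {G : ℕ → ℤ → Type} (δ : ∀ (n : ℕ) (a : ℤ), G n a → (freeOperad G).obj n (a - 1))
  (hd : ∀ (n : ℕ) (a : ℤ) (g : G n a),
    Presented.diff (noRel G) δ (fun h => False.elim h) (δ n a g) = 0) (Q : DGOperad)

/-- The morphism of dg operads from a quasi-free operad with prescribed values `φ` on the
generators, provided that `φ` is compatible with the differentials. -/
def quasiFree.lift (φ : ∀ {n : ℕ} {a : ℤ}, G n a → Q.obj n a)
    (hφ : ∀ (n : ℕ) (a : ℤ) (g : G n a),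
      Presented.freeLift Q.toNSOperad φ (δ n a g) = Q.d (φ g)) :
    DGOperad.Hom (quasiFree δ hd) Q where
  map := Presented.freeLift Q.toNSOperad φ
  map_one := rfl
  map_comp := Presented.freeLift_comp Q.toNSOperad φ
  map_d x := by
    obtain ⟨x, rfl⟩ := Quotient.exists_rep x
    change Presented.freeLift Q.toNSOperad φ (Presented.dTerm (noRel G) δ x)
      = Q.d (Presented.exprValue Q.toNSOperad φ x)
    -- Both sides obey the same Leibniz rule on composites, so the identity spreads from the
    -- generators to all expressions.
    induction x with
    | gen g => exact hφ _ _ g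
    | one => exact (map_zero _).trans Q.d_one.symm
    | zero => exact (map_zero _).trans (map_zero _).symm
    | add x y ihx ihy => rw [Presented.dTerm, Presented.exprValue, map_add, map_add, ihx, ihy]
    | neg x ih => rw [Presented.dTerm, Presented.exprValue, map_neg, map_neg, ih]
    | comp i hi hk hc x y ihx ihy =>
      rw [Presented.dTerm, Presented.exprValue,
        Q.d_comp i hi hk hc (by omega) (by omega), map_add, map_zsmul,
        Presented.freeLift_comp, Presented.freeLift_comp, ihx, ihy]
      rfl

variable {δ hd Q} in
/-- Morphisms from a quasi-free operad are determined by their values on the generators. -/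
theorem quasiFree.hom_ext {η θ : DGOperad.Hom (quasiFree δ hd) Q}
    (h : ∀ (n : ℕ) (a : ℤ) (g : G n a),
      η.map (Presented.gen (noRel G) g : (quasiFree δ hd).obj n a)
        = θ.map (Presented.gen (noRel G) g : (quasiFree δ hd).obj n a)) : η = θ := by
  have key : ∀ {n : ℕ} {a : ℤ} (x : OpTerm G n a),
      η.map (Presented.mk (noRel G) x : (quasiFree δ hd).obj n a)
        = θ.map (Presented.mk (noRel G) x : (quasiFree δ hd).obj n a) := by
    intro n a x
    induction x with
    | gen g => exact h _ _ g
    | one => exact η.map_one.trans θ.map_one.symm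
    | zero => exact (map_zero η.map).trans (map_zero θ.map).symm
    | add x y ihx ihy =>
      exact (map_add η.map _ _).trans ((congrArg₂ _ ihx ihy).trans (map_add θ.map _ _).symm)
    | neg x ih =>
      exact (map_neg η.map _).trans ((congrArg _ ih).trans (map_neg θ.map _).symm)
    | comp i hi hk hc x y ihx ihy =>
      exact (η.map_comp i hi hk hc _ _).trans
        ((congrArg₂ _ ihx ihy).trans (θ.map_comp i hi hk hc _ _).symm)
  refine DGOperad.Hom.ext ?_
  ext n a x
  obtain ⟨x, rfl⟩ := Quotient.exists_rep x
  exact key x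

end

/-- The map on the generators of the curved `A∞` operad given by a family `ν`. -/
def AGen.eval {Q : NSOperad} (ν : ∀ n : ℕ, Q.obj n (-1)) : ∀ {n : ℕ} {a : ℤ}, AGen n a → Q.obj n a
  | _, _, .mu n => ν n

/-- The morphism from the curved `A∞` operad given by a family of operations `ν n` with
`d (ν n) = -∑ ν ∘ ν`. -/
noncomputable def cAinf.lift (Q : DGOperad) (ν : ∀ n : ℕ, Q.obj n (-1))
    (hν : ∀ n, Q.d (ν n) = -Q.selfComp ν n) : DGOperad.Hom cAinf Q :=
  quasiFree.lift AGen.δ AGen.δ_δ Q (AGen.eval ν) (by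
    rintro _ _ ⟨n⟩
    simp only [AGen.δ, AGen.eval, hν, NSOperad.selfComp, map_neg, map_sum, Presented.freeLift_comp,
      Presented.freeLift_gen])

theorem cAinf.lift_mu (Q : DGOperad) (ν : ∀ n : ℕ, Q.obj n (-1))
    (hν : ∀ n, Q.d (ν n) = -Q.selfComp ν n) (n : ℕ) :
    (cAinf.lift Q ν hν).map (cAinf.mu n) = ν n := rfl

theorem cAinf.hom_ext {Q : DGOperad} {η θ : DGOperad.Hom cAinf Q}
    (h : ∀ n, η.map (cAinf.mu n) = θ.map (cAinf.mu n)) : η = θ :=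
  quasiFree.hom_ext fun _ _ g => by cases g; exact h _

theorem cAinf.d_mu (n : ℕ) : cAinf.d (cAinf.mu n) = -cAinf.selfComp cAinf.mu n := rfl

/-! ### Insertion of arity `0` operations into composites -/

namespace NSOperad

variable (P : NSOperad)

theorem plug_add {a : ℤ} : ∀ (w : List (Option (P.obj 0 0))) {s m k : ℕ}
    (hm : m = s + w.length) (hk : k = s + w.countP Option.isNone) (x y : P.obj m a),
    P.plug w hm hk (x + y) = P.plug w hm hk x + P.plug w hm hk y
  | [], s, m, k, hm, hk, x, y => by
    obtain rfl : m = k := hm.trans hk.symm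
    rfl
  | none :: w, _, _, _, _, _, x, y => plug_add w _ _ x y
  | some z :: w, _, _, _, _, _, x, y => by
    rw [plug, P.add_comp, plug_add]
    rfl

/-- Insertion of operations of arity `0` as an additive map. -/
def plugHom {a : ℤ} (w : List (Option (P.obj 0 0))) {s m k : ℕ}
    (hm : m = s + w.length) (hk : k = s + w.countP Option.isNone) : P.obj m a →+ P.obj k a :=
  AddMonoidHom.mk' (P.plug w hm hk) (P.plug_add w hm hk)

theorem plug_neg {a : ℤ} (w : List (Option (P.obj 0 0))) {s m k : ℕ}
    (hm : m = s + w.length) (hk : k = s + w.countP Option.isNone) (x : P.obj m a) :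
    P.plug w hm hk (-x) = -P.plug w hm hk x :=
  map_neg (P.plugHom w hm hk) x

theorem plug_zsmul {a : ℤ} (w : List (Option (P.obj 0 0))) {s m k : ℕ}
    (hm : m = s + w.length) (hk : k = s + w.countP Option.isNone) (t : ℤ) (x : P.obj m a) :
    P.plug w hm hk (t • x) = t • P.plug w hm hk x :=
  map_zsmul (P.plugHom w hm hk) t x

theorem plug_sum {a : ℤ} (w : List (Option (P.obj 0 0))) {s m k : ℕ}
    (hm : m = s + w.length) (hk : k = s + w.countP Option.isNone) {ι : Type*} (S : Finset ι)
    (f : ι → P.obj m a) :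
    P.plug w hm hk (∑ t ∈ S, f t) = ∑ t ∈ S, P.plug w hm hk (f t) :=
  map_sum (P.plugHom w hm hk) f S

/-- A family `μ` over all arities takes the place of a single operation, so the arity may change
along with the word and no transport appears. -/
theorem plug_congr {a : ℤ} (μ : ∀ n, P.obj n a) {w w' : List (Option (P.obj 0 0))}
    {s s' m m' k : ℕ} (hw : w = w') (hs : s = s')
    (hm : m = s + w.length) (hk : k = s + w.countP Option.isNone)
    (hm' : m' = s' + w'.length) (hk' : k = s' + w'.countP Option.isNone) :
    P.plug w hm hk (μ m) = P.plug w' hm' hk' (μ m') := by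
  subst hw hs
  obtain rfl : m = m' := hm.trans hm'.symm
  rfl

theorem comp_congr_index {m n k : ℕ} {a b c : ℤ} {i i' : ℕ} (h : i = i') (hi : i < m)
    (hi' : i' < m) (hk : k + 1 = m + n) (hc : a + b = c) (x : P.obj m a) (y : P.obj n b) :
    P.comp i hi hk hc x y = P.comp i' hi' hk hc x y := by
  subst h; rfl

/-- Insertions to the right of `y` in `x ∘ y` take place in `x`. -/
theorem plug_comp_right {a b c : ℤ} {m p : ℕ} (y : P.obj m b) (hc : a + b = c) :
    ∀ (w : List (Option (P.obj 0 0))) {u s s' l l' n k : ℕ} (x : P.obj l a)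
    (_hs : s = p + m + u) (_hs' : s' = p + 1 + u)
    (hi : p < l) (hn : n + 1 = l + m) (hm : n = s + w.length)
    (hk : k = s + w.countP Option.isNone) (hl : l = s' + w.length)
    (hl' : l' = s' + w.countP Option.isNone) (hi' : p < l') (hk' : k + 1 = l' + m),
    P.plug w hm hk (P.comp p hi hn hc x y) = P.comp p hi' hk' hc (P.plug w hl hl' x) y
  | [], u, s, s', l, l', n, k, x, hs, hs', hi, hn, hm, hk, hl, hl', hi', hk' => by
    obtain rfl : n = k := hm.trans hk.symm
    obtain rfl : l = l' := hl.trans hl'.symm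
    rfl
  | none :: w, u, s, s', l, l', n, k, x, hs, hs', hi, hn, hm, hk, hl, hl', hi', hk' =>
    -- Here `u` counts the inputs of `x` to the right of `y` that have been passed and left open.
    plug_comp_right y hc w (u := u + 1) x (by omega) (by omega) hi hn _ _ _ _ hi' hk'
  | some z :: w, u, s, s', l, l', n, k, x, hs, hs', hi, hn, hm, hk, hl, hl', hi', hk' => by
    rw [plug, plug]
    rw [List.length_cons] at hm hl
    -- Input `s` of the composite is input `s'` of `x`, which lies to the right of `p`. Parallel
    -- composition moves `z` into `x`, without a sign because `z` has degree `0`.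
    rw [P.comp_par p s' s (by omega) (by omega) hi (by omega) (by omega) (by omega)
      hn (by omega) (show l - 1 + 1 = l + 0 by omega) (by omega) hc (add_zero c) (add_zero a) hc,
      ksign_even (by simp), one_smul]
    exact plug_comp_right y hc w (u := u) _ (by omega) (by omega) _ _ _ _ _ _ hi' hk'

/-- Insertions into the inputs of `x ∘ y` that come from `y` or lie to the right of it. -/
theorem plug_comp_middle {a b c : ℤ} {p : ℕ} (hc : a + b = c) (w' : List (Option (P.obj 0 0))) :
    ∀ (w : List (Option (P.obj 0 0))) {u s m m' l l' n k : ℕ} (x : P.obj l a) (y : P.obj m b)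
    (_hs : s = p + u)
    (hi : p < l) (hn : n + 1 = l + m) (hm : n = s + (w ++ w').length)
    (hk : k = s + (w ++ w').countP Option.isNone) (hl : l = (p + 1) + w'.length)
    (hl' : l' = (p + 1) + w'.countP Option.isNone)
    (hm' : m = u + w.length) (hmm : m' = u + w.countP Option.isNone)
    (hi' : p < l') (hk' : k + 1 = l' + m'),
    P.plug (w ++ w') hm hk (P.comp p hi hn hc x y)
      = P.comp p hi' hk' hc (P.plug w' hl hl' x) (P.plug w hm' hmm y)
  | [], u, s, m, m', l, l', n, k, x, y, hs, hi, hn, hm, hk, hl, hl', hm', hmm, hi', hk' => by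
    obtain rfl : m = m' := hm'.trans hmm.symm
    simp only [List.length_nil, add_zero] at hm'
    -- Here `m = u`: all inputs of `y` have been passed, and what remains of the word concerns only
    -- `x`.
    exact P.plug_comp_right y hc w' (u := 0) x (by omega) (by omega) _ _ _ _ _ _ _ _
  | none :: w, u, s, m, m', l, l', n, k, x, y, hs, hi, hn, hm, hk, hl, hl', hm', hmm, hi', hk' =>
    plug_comp_middle hc w' w (u := u + 1) x y (by omega) hi hn _ _ hl hl' _ _ hi' hk'
  | some z :: w, u, s, m, m', l, l', n, k, x, y, hs, hi, hn, hm, hk, hl, hl', hm', hmm, hi',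
      hk' => by
    subst hs
    simp only [List.cons_append]
    rw [plug, plug]
    simp only [List.cons_append, List.length_cons] at hm hm'
    rw [P.comp_seq p u hi (by omega) (by omega) hn (by omega) (show m - 1 + 1 = m + 0 by omega)
      (by omega) hc (add_zero c) (add_zero b) hc]
    exact plug_comp_middle hc w' w (u := u) _ _ rfl _ _ _ _ _ _ _ _ hi' hk'

/-- Insertions into `x ∘ y` are insertions into `x` and into `y`. -/
theorem plug_comp {a b c : ℤ} (hc : a + b = c) (w₂ w₃ : List (Option (P.obj 0 0))) :
    ∀ (w₁ : List (Option (P.obj 0 0))) {s p p' m m' l l' n k : ℕ} (x : P.obj l a) (y : P.obj m b)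
    (_hp : p = s + w₁.length) (_hp' : p' = s + w₁.countP Option.isNone)
    (hi : p < l) (hn : n + 1 = l + m) (hm : n = s + (w₁ ++ (w₂ ++ w₃)).length)
    (hk : k = s + (w₁ ++ (w₂ ++ w₃)).countP Option.isNone)
    (hl : l = s + (w₁ ++ none :: w₃).length)
    (hl' : l' = s + (w₁ ++ none :: w₃).countP Option.isNone)
    (hm' : m = 0 + w₂.length) (hmm : m' = 0 + w₂.countP Option.isNone)
    (hi' : p' < l') (hk' : k + 1 = l' + m'),
    P.plug (w₁ ++ (w₂ ++ w₃)) hm hk (P.comp p hi hn hc x y)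
      = P.comp p' hi' hk' hc (P.plug (w₁ ++ none :: w₃) hl hl' x) (P.plug w₂ hm' hmm y)
  | [], s, p, p', m, m', l, l', n, k, x, y, hp, hp', hi, hn, hm, hk, hl, hl', hm', hmm, hi',
      hk' => by
    obtain rfl : p = s := hp
    obtain rfl : p' = p := hp'
    exact P.plug_comp_middle hc w₃ w₂ (u := 0) x y rfl _ _ _ _ _ _ _ _ _ _
  | none :: w₁, s, p, p', m, m', l, l', n, k, x, y, hp, hp', hi, hn, hm, hk, hl, hl', hm', hmm,
      hi', hk' => by
    simp only [List.length_cons, List.countP_cons, Option.isNone_none, if_true] at hp hp'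
    exact plug_comp hc w₂ w₃ w₁ (s := s + 1) x y (by omega) (by omega) hi hn _ _ _ _ hm' hmm hi' hk'
  | some z :: w₁, s, p, p', m, m', l, l', n, k, x, y, hp, hp', hi, hn, hm, hk, hl, hl', hm', hmm,
      hi', hk' => by
    simp only [List.cons_append]
    rw [plug, plug]
    simp only [List.length_cons, List.countP_cons, Option.isNone_some, List.cons_append]
      at hp hp' hm hl
    -- An insertion to the left of `y` is moved into `x` by parallel composition read from right to
    -- left. As `z` has arity `0`, the input that receives `y` moves from `p` to `p - 1`.
    have h := P.comp_par s p (p - 1) (by omega) (by omega) (show s < l by omega) hi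
      (show p - 1 < l - 1 by omega) (show s < n by omega) (by omega) (by omega) hn
      (show n - 1 + 1 = n + 0 by omega) (add_zero a) hc hc (add_zero c) x z y
    rw [ksign_even (by simp), one_smul] at h
    rw [← h]
    exact plug_comp hc w₂ w₃ w₁ (s := s) _ _ (by omega) (by simpa using hp') _ _ _ _ _ _ hm' hmm
      hi' hk'

end NSOperad

theorem Finset.sum_range_length_cons {α M : Type*} [AddCommMonoid M] (c : α) (w : List α)
    (f : ℕ → M) : ∑ i ∈ Finset.range (c :: w).length, f i
      = ∑ i ∈ Finset.range w.length, f (i + 1) + f 0 :=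
  Finset.sum_range_succ' f w.length

/-! ### Insertion of copies of one operation, and the Leibniz rule -/

namespace NSOperad

variable (P : NSOperad) (e : P.obj 0 0)

/-- `P.ins e w _ _ x` inserts `e` into some of the last `w.length` inputs of `x`: a letter
`some ()` stands for an input that receives `e`, a letter `none` for an input that stays open. -/
def ins {a : ℤ} (w : List (Option Unit)) {s m k : ℕ} (hm : m = s + w.length)
    (hk : k = s + w.countP Option.isNone) (x : P.obj m a) : P.obj k a :=
  P.plug (w.map (Option.map fun _ => e)) (by simpa using hm)
    (by simpa [List.countP_map, Function.comp_def] using hk) x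

variable {P e}

theorem ins_add {a : ℤ} (w : List (Option Unit)) {s m k : ℕ} (hm : m = s + w.length)
    (hk : k = s + w.countP Option.isNone) (x y : P.obj m a) :
    P.ins e w hm hk (x + y) = P.ins e w hm hk x + P.ins e w hm hk y :=
  P.plug_add _ _ _ x y

theorem ins_neg {a : ℤ} (w : List (Option Unit)) {s m k : ℕ} (hm : m = s + w.length)
    (hk : k = s + w.countP Option.isNone) (x : P.obj m a) :
    P.ins e w hm hk (-x) = -P.ins e w hm hk x :=
  P.plug_neg _ _ _ x

theorem ins_zsmul {a : ℤ} (w : List (Option Unit)) {s m k : ℕ} (hm : m = s + w.length)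
    (hk : k = s + w.countP Option.isNone) (t : ℤ) (x : P.obj m a) :
    P.ins e w hm hk (t • x) = t • P.ins e w hm hk x :=
  P.plug_zsmul _ _ _ t x

theorem ins_sum {a : ℤ} (w : List (Option Unit)) {s m k : ℕ} (hm : m = s + w.length)
    (hk : k = s + w.countP Option.isNone) {ι : Type*} (S : Finset ι) (f : ι → P.obj m a) :
    P.ins e w hm hk (∑ t ∈ S, f t) = ∑ t ∈ S, P.ins e w hm hk (f t) :=
  P.plug_sum _ _ _ S f

theorem ins_none {a : ℤ} (w : List (Option Unit)) {s m k : ℕ} (hm : m = s + (none :: w).length)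
    (hk : k = s + (none :: w).countP Option.isNone) (x : P.obj m a) :
    P.ins e (none :: w) hm hk x = P.ins e w (s := s + 1) (by rw [hm, List.length_cons]; omega)
      (by rw [hk, List.countP_cons]; simp; omega) x := rfl

theorem ins_some {a : ℤ} (w : List (Option Unit)) {s m k : ℕ}
    (hm : m = s + (some () :: w).length)
    (hk : k = s + (some () :: w).countP Option.isNone) (x : P.obj m a) :
    P.ins e (some () :: w) hm hk x
      = P.ins e w (s := s) (m := m - 1) (by rw [hm, List.length_cons]; omega)
        (by rw [hk, List.countP_cons]; simp)
        (P.comp s (by rw [hm, List.length_cons]; omega)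
          (by rw [List.length_cons] at hm; omega) (add_zero a) x e) := rfl

theorem ins_congr {a : ℤ} (μ : ∀ n, P.obj n a) {w w' : List (Option Unit)}
    {s s' m m' k : ℕ} (hw : w = w') (hs : s = s')
    (hm : m = s + w.length) (hk : k = s + w.countP Option.isNone)
    (hm' : m' = s' + w'.length) (hk' : k = s' + w'.countP Option.isNone) :
    P.ins e w hm hk (μ m) = P.ins e w' hm' hk' (μ m') :=
  P.plug_congr μ (by rw [hw]) hs _ _ _ _

/-- The input of `x` that receives `y` must stay open during the insertions into `x`; this is the
letter `none` between `w₁` and `w₃`. After the insertions its number is the count of open inputs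
before it, which is why `p` becomes `p'`. -/
theorem ins_comp {a b c : ℤ} (hc : a + b = c) (w₁ w₂ w₃ : List (Option Unit))
    {s p p' m m' l l' n k : ℕ} (x : P.obj l a) (y : P.obj m b)
    (hp : p = s + w₁.length) (hp' : p' = s + w₁.countP Option.isNone)
    (hi : p < l) (hn : n + 1 = l + m) (hm : n = s + (w₁ ++ (w₂ ++ w₃)).length)
    (hk : k = s + (w₁ ++ (w₂ ++ w₃)).countP Option.isNone)
    (hl : l = s + (w₁ ++ none :: w₃).length)
    (hl' : l' = s + (w₁ ++ none :: w₃).countP Option.isNone)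
    (hm' : m = 0 + w₂.length) (hmm : m' = 0 + w₂.countP Option.isNone)
    (hi' : p' < l') (hk' : k + 1 = l' + m') :
    P.ins e (w₁ ++ (w₂ ++ w₃)) hm hk (P.comp p hi hn hc x y)
      = P.comp p' hi' hk' hc (P.ins e (w₁ ++ none :: w₃) hl hl' x) (P.ins e w₂ hm' hmm y) := by
  simp only [ins, List.map_append, List.map_cons, Option.map_none]
  exact P.plug_comp hc _ _ _ x y (by simpa using hp)
    (by simpa [List.countP_map, Function.comp_def] using hp') _ _ _ _ _ _ _ _ _ _

/-- The composite of `x` with copies of `e` in the places given by `w₁` and `w₂`, and with `y`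
in the input between `w₁` and `w₂`; zero if the arities do not match. -/
def insWith (e : P.obj 0 0) (s : ℕ) {m k : ℕ} {a b c : ℤ} (hc : a + b = c)
    (x : P.obj m a) (y : P.obj 0 b) (w₁ w₂ : List (Option Unit)) : P.obj k c :=
  if h : m = s + (w₁ ++ none :: w₂).length ∧
      k + 1 = s + (w₁ ++ none :: w₂).countP Option.isNone then
    P.comp (s + w₁.countP Option.isNone) (by
      have h₂ := h.2
      rw [List.countP_append, List.countP_cons, Option.isNone_none, if_pos rfl] at h₂
      omega) (add_zero _).symm hc (P.ins e (w₁ ++ none :: w₂) h.1 h.2 x) y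
  else 0

/-- The arity conditions of the two sides are equivalent, so the default value `0` occurs on both
sides or on neither. -/
theorem insWith_none {s m k : ℕ} {a b c : ℤ} (hc : a + b = c)
    (x : P.obj m a) (y : P.obj 0 b) (w₁ w₂ : List (Option Unit)) :
    (insWith e s hc x y (none :: w₁) w₂ : P.obj k c) = insWith e (s + 1) hc x y w₁ w₂ := by
  simp only [insWith]
  by_cases h : m = s + 1 + (w₁ ++ none :: w₂).length ∧
      k + 1 = s + 1 + (w₁ ++ none :: w₂).countP Option.isNone
  · rw [dif_pos h, dif_pos (by simp at h ⊢; omega)]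
    exact P.comp_congr_index (by simp; omega) _ _ _ _ _ _
  · rw [dif_neg h, dif_neg (by simp at h ⊢; omega)]

theorem insWith_some {s m k : ℕ} {a b c : ℤ} (hc : a + b = c) (hm : s < m)
    (x : P.obj m a) (y : P.obj 0 b) (w₁ w₂ : List (Option Unit)) :
    (insWith e s hc x y (some () :: w₁) w₂ : P.obj k c)
      = insWith e s hc (P.comp (k := m - 1) s hm (by omega) (add_zero a) x e) y w₁ w₂ := by
  simp only [insWith]
  by_cases h : m - 1 = s + (w₁ ++ none :: w₂).length ∧
      k + 1 = s + (w₁ ++ none :: w₂).countP Option.isNone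
  · rw [dif_pos h, dif_pos (by simp at h ⊢; omega)]
    exact P.comp_congr_index (by simp) _ _ _ _ _ _
  · rw [dif_neg h, dif_neg (by simp at h ⊢; omega)]

/-- With nothing to insert before `y`, composing with `y` first or last gives the same result, by
`ins_comp` with the first two words empty. -/
theorem insWith_nil {s m k n : ℕ} {a b c : ℤ} (hc : a + b = c) (x : P.obj m a) (y : P.obj 0 b)
    (w : List (Option Unit)) (hi : s < m) (hn : n + 1 = m + 0) (hm : n = s + w.length)
    (hk : k = s + w.countP Option.isNone) :
    (insWith e s hc x y [] w : P.obj k c) = P.ins e w hm hk (P.comp s hi hn hc x y) := by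
  rw [insWith, dif_pos (by simp; omega)]
  exact (P.ins_comp hc [] [] w (s := s) x y (by simp) (by simp) _ _ _ _ _ _ (by simp) (by simp)
    _ _).symm

end NSOperad

/-- Leibniz rule, by induction on the word. The differential hits either `x` or one of the copies of
`e`. Since `e` has degree `0`, every term of the second kind carries the same sign, that of passing
`x`. -/
theorem DGOperad.d_ins (P : DGOperad) (e : P.obj 0 0) : ∀ (w : List (Option Unit)) {s m k : ℕ}
    {a : ℤ} (hc : a + (0 - 1) = a - 1) (hm : m = s + w.length)
    (hk : k = s + w.countP Option.isNone) (x : P.obj m a),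
    P.d (P.ins e w hm hk x) = P.ins e w hm hk (P.d x)
      + ksign a • ∑ i ∈ Finset.range w.length, if w[i]? = some (some ()) then
          NSOperad.insWith e s hc x (P.d e) (w.take i) (w.drop (i + 1)) else 0
  | [], s, m, k, a, hc, hm, hk, x => by
    obtain rfl : m = k := hm.trans hk.symm
    simp [NSOperad.ins, NSOperad.plug]
  | none :: w, s, m, k, a, hc, hm, hk, x => by
    rw [NSOperad.ins_none, DGOperad.d_ins P e w hc, Finset.sum_range_length_cons]
    simp [NSOperad.insWith_none, NSOperad.ins_none]
  | some () :: w, s, m, k, a, hc, hm, hk, x => by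
    have hm' := hm
    rw [List.length_cons] at hm'
    rw [NSOperad.ins_some, DGOperad.d_ins P e w hc, Finset.sum_range_length_cons,
      P.d_comp _ _ _ _ (add_zero _) hc, NSOperad.ins_add]
    simp only [List.getElem?_cons_succ, List.take_succ_cons, List.drop_succ_cons,
      List.getElem?_cons_zero, List.take_zero, List.drop_zero, if_true, zero_add]
    simp only [NSOperad.insWith_some hc (show s < m by omega), smul_add]
    -- The term with index `0`, where the differential hits the copy of `e` that the first letter
    -- inserts.
    rw [NSOperad.insWith_nil hc x (P.d e) w (by omega) (show m - 1 + 1 = m + 0 by omega)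
      (by omega) (by simpa using hk), NSOperad.ins_some]
    rw [← NSOperad.ins_zsmul]
    abel

/-! ### Words in the letters `none` and `some ()` -/

theorem List.length_eq_countP_isNone_add {α : Type*} (w : List (Option α)) :
    w.length = w.countP Option.isNone + w.countP Option.isSome := by
  induction w with
  | nil => rfl
  | cons c w ih => cases c <;> simp [ih] <;> omega

/-- The cut is at the open input number `p`, counted from `0`: this is where an outer factor with `p
+ 1 + r` open inputs receives the inner one. -/
theorem List.exists_eq_append_none_cons {α : Type*} {w : List (Option α)} {p r : ℕ}
    (h : w.countP Option.isNone = p + 1 + r) : ∃ w₁ w₂ : List (Option α), w = w₁ ++ none :: w₂ ∧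
      w₁.countP Option.isNone = p ∧ w₂.countP Option.isNone = r := by
  induction w generalizing p with
  | nil => simp at h; omega
  | cons c w ih =>
    cases c with
    | none =>
      rw [List.countP_cons, Option.isNone_none, if_pos rfl] at h
      cases p with
      | zero => exact ⟨[], w, rfl, rfl, by omega⟩
      | succ p =>
        obtain ⟨w₁, w₂, rfl, h₁, h₂⟩ := ih (p := p) (by omega)
        exact ⟨none :: w₁, w₂, rfl, by simp [h₁], h₂⟩
    | some c =>
      obtain ⟨w₁, w₂, rfl, h₁, h₂⟩ := ih (p := p) (by simpa using h)
      exact ⟨some c :: w₁, w₂, rfl, by simp [h₁], h₂⟩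

/-- The number of letters `none` before the cut determines its place. -/
theorem List.append_none_cons_inj {α : Type*} {w₁ w₂ v₁ v₂ : List (Option α)}
    (hc : w₁.countP Option.isNone = v₁.countP Option.isNone)
    (h : w₁ ++ none :: w₂ = v₁ ++ none :: v₂) : w₁ = v₁ ∧ w₂ = v₂ := by
  induction w₁ generalizing v₁ with
  | nil =>
    cases v₁ with
    | nil => simpa using h
    | cons c v₁ =>
      obtain ⟨rfl, -⟩ := List.cons_eq_cons.1 h
      simp at hc
  | cons c w₁ ih =>
    cases v₁ with
    | nil =>
      obtain ⟨rfl, -⟩ := List.cons_eq_cons.1 h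
      simp at hc
    | cons d v₁ =>
      obtain ⟨rfl, h'⟩ := List.cons_eq_cons.1 h
      obtain ⟨rfl, rfl⟩ := ih (by simpa [List.countP_cons] using hc) h'
      exact ⟨rfl, rfl⟩

theorem finite_words (N : ℕ) : {w : List (Option Unit) | w.length ≤ N}.Finite :=
  List.finite_length_le (Option Unit) N

/-- The words with `n` letters `none` and fewer than `t` letters `some ()`. -/
noncomputable def words (n t : ℕ) : Finset (List (Option Unit)) :=
  Set.Finite.toFinset (s := {w | w.countP Option.isNone = n ∧ w.countP Option.isSome < t})
    ((finite_words (n + t)).subset fun w hw => by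
      have := w.length_eq_countP_isNone_add
      simp only [Set.mem_ofPred_eq] at hw ⊢
      omega)

theorem mem_words {n t : ℕ} {w : List (Option Unit)} :
    w ∈ words n t ↔ w.countP Option.isNone = n ∧ w.countP Option.isSome < t := by
  simp [words]

/-- The pairs of words with `n` letters `none` and fewer than `t` letters `some ()`. -/
noncomputable def wordPairs (n t : ℕ) : Finset (List (Option Unit) × List (Option Unit)) :=
  Set.Finite.toFinset (s := {x | (x.1 ++ x.2).countP Option.isNone = n ∧
      (x.1 ++ x.2).countP Option.isSome < t})
    (((finite_words (n + t)).prod (finite_words (n + t))).subset fun x hx => by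
      have h₁ := x.1.length_eq_countP_isNone_add
      have h₂ := x.2.length_eq_countP_isNone_add
      simp only [Set.mem_ofPred_eq, Set.mem_prod, List.countP_append] at hx ⊢
      omega)

theorem mem_wordPairs {n t : ℕ} {x : List (Option Unit) × List (Option Unit)} :
    x ∈ wordPairs n t ↔ x.1.countP Option.isNone + x.2.countP Option.isNone = n ∧
      x.1.countP Option.isSome + x.2.countP Option.isSome < t := by
  simp [wordPairs]

/-- The triples of words with `n` letters `none` and fewer than `t` letters `some ()`. -/
noncomputable def wordTriples (n t : ℕ) :
    Finset (List (Option Unit) × List (Option Unit) × List (Option Unit)) :=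
  Set.Finite.toFinset (s := {x | (x.1 ++ (x.2.1 ++ x.2.2)).countP Option.isNone = n ∧
      (x.1 ++ (x.2.1 ++ x.2.2)).countP Option.isSome < t})
    (((finite_words (n + t)).prod ((finite_words (n + t)).prod (finite_words (n + t)))).subset
      fun x hx => by
        have h₁ := x.1.length_eq_countP_isNone_add
        have h₂ := x.2.1.length_eq_countP_isNone_add
        have h₃ := x.2.2.length_eq_countP_isNone_add
        simp only [Set.mem_ofPred_eq, Set.mem_prod, List.countP_append] at hx ⊢
        omega)

theorem mem_wordTriples {n t : ℕ}
    {x : List (Option Unit) × List (Option Unit) × List (Option Unit)} :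
    x ∈ wordTriples n t ↔
      x.1.countP Option.isNone + x.2.1.countP Option.isNone + x.2.2.countP Option.isNone = n ∧
      x.1.countP Option.isSome + x.2.1.countP Option.isSome + x.2.2.countP Option.isSome < t := by
  simp [wordTriples, add_assoc]

/-- The triples of words with `n` letters `none`, and with fewer than `t` letters `some ()` in the
outer two words as well as in the middle one. -/
noncomputable def wordTriples' (n t : ℕ) :
    Finset (List (Option Unit) × List (Option Unit) × List (Option Unit)) :=
  {x ∈ wordTriples n (t + t) | x.1.countP Option.isSome + x.2.2.countP Option.isSome < t ∧
    x.2.1.countP Option.isSome < t}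

/-- The bound `t + t` in the definition serves only finiteness, as it follows from the two separate
bounds. -/
theorem mem_wordTriples' {n t : ℕ}
    {x : List (Option Unit) × List (Option Unit) × List (Option Unit)} :
    x ∈ wordTriples' n t ↔
      x.1.countP Option.isNone + x.2.1.countP Option.isNone + x.2.2.countP Option.isNone = n ∧
      x.1.countP Option.isSome + x.2.2.countP Option.isSome < t ∧
        x.2.1.countP Option.isSome < t := by
  rw [wordTriples', Finset.mem_filter, mem_wordTriples]
  omega

section
variable {M : Type*} [AddCommMonoid M]

/-- Reindexes the terms from `d μ`: the summands of the differential of `μ w.length` are the splits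
of `w.length`, that is, the ways to cut `w` into three consecutive pieces. -/
theorem sum_words_splits (n t : ℕ)
    (f : List (Option Unit) × List (Option Unit) × List (Option Unit) → M) :
    ∑ w ∈ words n t, ∑ s : Split w.length,
        f (w.take s.p, (w.drop s.p).take s.q, (w.drop s.p).drop s.q)
      = ∑ x ∈ wordTriples n t, f x := by
  rw [Finset.sum_sigma']
  refine (Finset.sum_bij (fun x _ => (⟨x.1 ++ (x.2.1 ++ x.2.2),
    ⟨x.1.length, x.2.1.length, x.2.2.length, by simp [add_assoc]⟩⟩ :
      Σ w : List (Option Unit), Split w.length)) ?_ ?_ ?_ ?_).symm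
  · intro x hx
    rw [mem_wordTriples] at hx
    simp only [Finset.mem_sigma, mem_words, Finset.mem_univ, and_true, List.countP_append]
    omega
  · rintro ⟨x₁, x₂, x₃⟩ hx ⟨y₁, y₂, y₃⟩ hy h
    -- The type of the second component depends on the word, so only its numerical fields are
    -- compared.
    have key : ∀ {z z' : Σ w : List (Option Unit), Split w.length}, z = z' →
        z.1 = z'.1 ∧ z.2.p = z'.2.p ∧ z.2.q = z'.2.q := by rintro z _ rfl; exact ⟨rfl, rfl, rfl⟩
    obtain ⟨h₁, h₂, h₃⟩ := key h
    dsimp only at h₁ h₂ h₃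
    obtain ⟨rfl, h₄⟩ := List.append_inj h₁ h₂
    obtain ⟨rfl, rfl⟩ := List.append_inj h₄ h₃
    rfl
  · rintro ⟨w, p, q, r, h⟩ hw
    simp only [Finset.mem_sigma, mem_words, Finset.mem_univ, and_true] at hw
    obtain ⟨w₁, w', rfl, rfl⟩ : ∃ w₁ w', w = w₁ ++ w' ∧ w₁.length = p :=
      ⟨w.take p, w.drop p, (List.take_append_drop p w).symm, by simp; omega⟩
    rw [List.length_append] at h
    obtain ⟨w₂, w₃, rfl, rfl⟩ : ∃ w₂ w₃, w' = w₂ ++ w₃ ∧ w₂.length = q :=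
      ⟨w'.take q, w'.drop q, (List.take_append_drop q w').symm, by simp; omega⟩
    rw [List.length_append] at h
    obtain rfl : w₃.length = r := by omega
    refine ⟨(w₁, w₂, w₃), ?_, rfl⟩
    rw [mem_wordTriples]
    simp only [List.countP_append] at hw ⊢
    omega
  · rintro ⟨x₁, x₂, x₃⟩ hx
    simp

/-- Reindexes the terms from `d α`: the marked letter `some ()` is removed, so the remaining pair
has one insertion less, and `t + 1` turns into `t`. -/
theorem sum_words_letters (n t : ℕ) (f : List (Option Unit) × List (Option Unit) → M) :
    ∑ w ∈ words n (t + 1), ∑ i ∈ Finset.range w.length,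
        (if w[i]? = some (some ()) then f (w.take i, w.drop (i + 1)) else 0)
      = ∑ x ∈ wordPairs n t, f x := by
  simp only [← Finset.sum_filter]
  rw [Finset.sum_sigma']
  refine (Finset.sum_bij (fun x _ => (⟨x.1 ++ some () :: x.2, x.1.length⟩ :
      Σ _ : List (Option Unit), ℕ)) ?_ ?_ ?_ ?_).symm
  · intro x hx
    rw [mem_wordPairs] at hx
    simp only [Finset.mem_sigma, mem_words, Finset.mem_filter, Finset.mem_range]
    simp
    omega
  · rintro ⟨x₁, x₂⟩ hx ⟨y₁, y₂⟩ hy h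
    simp only [Sigma.mk.injEq, heq_eq_eq] at h
    obtain ⟨rfl, h₁⟩ := List.append_inj h.1 h.2
    simpa using h₁
  · rintro ⟨w, i⟩ hw
    simp only [Finset.mem_sigma, mem_words, Finset.mem_filter, Finset.mem_range] at hw
    obtain ⟨hw, hi, hwi⟩ := hw
    have e : w = w.take i ++ some () :: w.drop (i + 1) := by
      rw [List.getElem?_eq_getElem hi, Option.some_inj] at hwi
      rw [← hwi, List.cons_getElem_drop_succ, List.take_append_drop]
    refine ⟨(w.take i, w.drop (i + 1)), ?_, ?_⟩
    · rw [e] at hw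
      rw [mem_wordPairs]
      simp at hw ⊢
      omega
    · simp only [Sigma.mk.injEq, heq_eq_eq]
      exact ⟨e.symm, by simp; omega⟩
  · rintro ⟨x₁, x₂⟩ hx
    simp

end

/-! ### Twisting by an operation of arity `0` and degree `0` -/

namespace NSOperad

variable (P : NSOperad) (e : P.obj 0 0) (μ : ∀ n : ℕ, P.obj n (-1))

/-- The operation of arity `n` obtained from `μ w.length` by inserting `e` as described by the
word `w`; zero if `w` has not exactly `n` letters `none`. -/
def insMu (n : ℕ) (w : List (Option Unit)) : P.obj n (-1) :=
  if h : n = w.countP Option.isNone then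
    P.ins e w (s := 0) (zero_add _).symm (h.trans (zero_add _).symm) (μ w.length)
  else 0

/-- The composite of two operations `insMu`, one for the outer words of a triple and one for the
middle word; zero if the arity is not `n`. -/
def insTriple (n : ℕ) (x : List (Option Unit) × List (Option Unit) × List (Option Unit)) :
    P.obj n (-1 - 1) :=
  if h : x.1.countP Option.isNone + x.2.1.countP Option.isNone + x.2.2.countP Option.isNone = n
  then P.comp (x.1.countP Option.isNone) (by omega) (by omega) (by norm_num)
    (P.insMu e μ (x.1.countP Option.isNone + 1 + x.2.2.countP Option.isNone)
      (x.1 ++ none :: x.2.2)) (P.insMu e μ (x.2.1.countP Option.isNone) x.2.1)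
  else 0

/-- The composite of `insMu` for a word `w₁, none, w₂` with `y` in the input in the middle. -/
def insPair (y : P.obj 0 (-1)) (n : ℕ) (x : List (Option Unit) × List (Option Unit)) :
    P.obj n (-1 - 1) :=
  insWith e 0 (by norm_num) (μ (x.1.length + 1 + x.2.length)) y x.1 x.2

/-- The sum of the `insMu` with fewer than `t` insertions. -/
noncomputable def twistSum (t n : ℕ) : P.obj n (-1) := ∑ w ∈ words n t, P.insMu e μ n w

variable {P e μ}

theorem insMu_append_none_cons {n : ℕ} {w₁ w₂ : List (Option Unit)}
    {l : ℕ} (hl : l = 0 + (w₁ ++ none :: w₂).length)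
    (hn : n = 0 + (w₁ ++ none :: w₂).countP Option.isNone) :
    P.insMu e μ n (w₁ ++ none :: w₂) = P.ins e (w₁ ++ none :: w₂) hl hn (μ l) := by
  rw [insMu, dif_pos (hn.trans (zero_add _))]
  exact ins_congr μ rfl rfl _ _ _ _

/-- The lengths of the three pieces give the split before the insertions; their numbers of letters
`none` give the split after them. Thus a term of `d μ` becomes a term of the quadratic expression in
the twisted operations. -/
theorem ins_comp_mu {w₁ w₂ w₃ : List (Option Unit)} {m n p l q : ℕ} (hp : p = w₁.length)
    (hq : q = w₂.length) (hl : l = p + 1 + w₃.length) (hi : p < l) (hn : m + 1 = l + q)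
    (hc : (-1 : ℤ) + -1 = -1 - 1) (hm : m = 0 + (w₁ ++ (w₂ ++ w₃)).length)
    (hk : n = 0 + (w₁ ++ (w₂ ++ w₃)).countP Option.isNone) :
    P.ins e (w₁ ++ (w₂ ++ w₃)) hm hk (P.comp p hi hn hc (μ l) (μ q))
      = P.insTriple e μ n (w₁, w₂, w₃) := by
  subst hq
  have hk' := hk
  simp only [List.countP_append] at hk'
  rw [insTriple, dif_pos (by dsimp only; omega)]
  dsimp only
  rw [ins_comp hc w₁ w₂ w₃ (s := 0) (p' := w₁.countP Option.isNone)
    (l' := w₁.countP Option.isNone + 1 + w₃.countP Option.isNone)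
    (m' := w₂.countP Option.isNone) (μ l) (μ _) (by omega) (by omega) hi hn hm hk
    (by simp; omega) (by simp; omega) (by omega) (by omega) (by omega) (by omega)]
  congr 1
  · exact (insMu_append_none_cons _ _).symm
  · rw [insMu, dif_pos rfl]

theorem insWith_mu {y : P.obj 0 (-1)} {n m : ℕ} {w₁ w₂ : List (Option Unit)}
    (hm : m = w₁.length + 1 + w₂.length) (hc : (-1 : ℤ) + -1 = -1 - 1) :
    (insWith e 0 hc (μ m) y w₁ w₂ : P.obj n (-1 - 1)) = P.insPair e μ y n (w₁, w₂) := by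
  subst hm; rfl

theorem comp_ins_congr {w : List (Option Unit)} {l m m' k i i' : ℕ} {a b c : ℤ} (x : P.obj l a)
    (y : P.obj 0 b) (h : m = m') (h' : i = i') (hc : a + b = c) (hi : i < m) (hk : k + 1 = m + 0)
    (hl : l = 0 + w.length) (hm : m = 0 + w.countP Option.isNone) (hi' : i' < m')
    (hk' : k + 1 = m' + 0) (hl' : l = 0 + w.length) (hm' : m' = 0 + w.countP Option.isNone) :
    P.comp i hi hk hc (P.ins e w hl hm x) y = P.comp i' hi' hk' hc (P.ins e w hl' hm' x) y := by
  subst h h'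
  rfl

theorem insPair_eq {y : P.obj 0 (-1)} {n p : ℕ} {w₁ w₂ : List (Option Unit)} {m : ℕ}
    (hp : p = w₁.countP Option.isNone) (hm : m = p + 1 + w₂.countP Option.isNone) (hi : p < m)
    (hn : n + 1 = m + 0) (hc : (-1 : ℤ) + -1 = -1 - 1) :
    P.comp p hi hn hc (P.insMu e μ m (w₁ ++ none :: w₂)) y = P.insPair e μ y n (w₁, w₂) := by
  subst hp hm
  obtain rfl : n = w₁.countP Option.isNone + w₂.countP Option.isNone := by omega
  rw [insPair, insWith, dif_pos (by simp; omega)]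
  rw [insMu_append_none_cons (l := w₁.length + 1 + w₂.length) (by simp; omega)
    (by simp; omega)]
  exact comp_ins_congr _ _ (by omega) (by simp) _ _ _ _ _ _ _ _ _

/-- A split, a word for the outer factor and a word for the inner one amount to a triple, since the
outer word has a unique cut at its open input number `p`. The factors are truncated separately,
whence `wordTriples'` instead of `wordTriples`. -/
theorem sum_split_comp_twistSum (t n : ℕ) :
    P.selfComp (P.twistSum e μ t) n = ∑ x ∈ wordTriples' n t, P.insTriple e μ n x := by
  simp only [selfComp, twistSum, sum_comp, comp_sum]
  simp only [← Finset.sum_product']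
  rw [Finset.sum_sigma']
  refine (Finset.sum_bij (fun x hx => (⟨⟨x.1.countP Option.isNone, x.2.1.countP Option.isNone,
    x.2.2.countP Option.isNone, (mem_wordTriples'.1 hx).1⟩, (x.2.1, x.1 ++ none :: x.2.2)⟩ :
      Σ _ : Split n, List (Option Unit) × List (Option Unit))) ?_ ?_ ?_ ?_).symm
  · intro x hx
    rw [mem_wordTriples'] at hx
    simp only [Finset.mem_sigma, Finset.mem_product, mem_words, Finset.mem_univ, true_and]
    simp
    omega
  · rintro ⟨x₁, x₂, x₃⟩ hx ⟨y₁, y₂, y₃⟩ hy h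
    simp only [Sigma.mk.injEq, Split.mk.injEq, heq_eq_eq, Prod.mk.injEq] at h
    obtain ⟨rfl, rfl⟩ := List.append_none_cons_inj h.1.1 h.2.2
    obtain rfl := h.2.1
    rfl
  · rintro ⟨⟨p, q, r, h⟩, w₂, v⟩ hx
    simp only [Finset.mem_sigma, Finset.mem_product, mem_words, Finset.mem_univ, true_and] at hx
    obtain ⟨w₁, w₃, rfl, rfl, rfl⟩ := List.exists_eq_append_none_cons hx.2.1
    obtain rfl := hx.1.1
    refine ⟨(w₁, w₂, w₃), ?_, rfl⟩
    rw [mem_wordTriples']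
    simp at hx
    exact ⟨h, by dsimp only; omega⟩
  · rintro ⟨x₁, x₂, x₃⟩ hx
    rw [insTriple, dif_pos (mem_wordTriples'.1 hx).1]

/-- The family of operations with value `y` in arity `0` and zero in positive arities. -/
def inZero (y : P.obj 0 (-1)) : ∀ n : ℕ, P.obj n (-1)
  | 0 => y
  | _ + 1 => 0

theorem inZero_pos (y : P.obj 0 (-1)) {n : ℕ} (h : 0 < n) : inZero y n = 0 := by
  cases n with
  | zero => omega
  | succ n => rfl

theorem sum_split_comp_inZero (y : P.obj 0 (-1)) (t n : ℕ) :
    ∑ s : Split n, P.comp (k := n) s.p (by omega) (by have := s.sum_eq; omega)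
        (show (-1 : ℤ) + -1 = -1 - 1 by norm_num) (P.twistSum e μ t (s.p + 1 + s.r))
        (inZero y s.q)
      = ∑ x ∈ wordPairs n t, P.insPair e μ y n x := by
  classical
  -- Only splits with `q = 0` contribute, because `inZero y` vanishes in positive arities.
  rw [← Finset.sum_filter_add_sum_filter_not _ (fun s : Split n => s.q = 0),
    Finset.sum_eq_zero (s := Finset.filter (fun s : Split n => ¬ s.q = 0) _), add_zero]
  swap
  · intro s hs
    rw [inZero_pos y (Nat.pos_of_ne_zero (Finset.mem_filter.1 hs).2), comp_zero]
  simp only [twistSum, sum_comp]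
  rw [Finset.sum_sigma']
  refine (Finset.sum_bij (fun x hx => (⟨⟨x.1.countP Option.isNone, 0,
    x.2.countP Option.isNone, (mem_wordPairs.1 hx).1⟩, x.1 ++ none :: x.2⟩ :
      Σ _ : Split n, List (Option Unit))) ?_ ?_ ?_ ?_).symm
  · intro x hx
    rw [mem_wordPairs] at hx
    simp only [Finset.mem_sigma, Finset.mem_filter, mem_words, Finset.mem_univ, true_and]
    simp
    omega
  · rintro ⟨x₁, x₂⟩ hx ⟨y₁, y₂⟩ hy h
    simp only [Sigma.mk.injEq, Split.mk.injEq, heq_eq_eq] at h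
    obtain ⟨rfl, rfl⟩ := List.append_none_cons_inj h.1.1 h.2
    rfl
  · rintro ⟨⟨p, q, r, h⟩, v⟩ hx
    simp only [Finset.mem_sigma, Finset.mem_filter, mem_words, Finset.mem_univ, true_and] at hx
    obtain ⟨rfl, hx⟩ := hx
    obtain ⟨w₁, w₃, rfl, rfl, rfl⟩ := List.exists_eq_append_none_cons hx.1
    refine ⟨(w₁, w₃), ?_, rfl⟩
    rw [mem_wordPairs]
    simp at hx
    exact ⟨by simpa using h, by dsimp only; omega⟩
  · rintro ⟨x₁, x₂⟩ hx
    exact (insPair_eq rfl rfl _ _ _).symm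

theorem selfComp_add_inZero (y : P.obj 0 (-1)) (t n : ℕ) :
    P.selfComp (fun n => inZero y n + P.twistSum e μ t n) n
      = ∑ x ∈ wordPairs n t, P.insPair e μ y n x
        + ∑ x ∈ wordTriples' n t, P.insTriple e μ n x := by
  rw [← sum_split_comp_inZero, ← sum_split_comp_twistSum, selfComp, selfComp,
    ← Finset.sum_add_distrib]
  refine Finset.sum_congr rfl fun s _ => ?_
  -- The outer factor has positive arity, so `y` can occur only as the inner one.
  rw [inZero_pos y (show 0 < s.p + 1 + s.r by omega), zero_add, comp_add]

end NSOperad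

/-! ### The curved equation for truncated twisted operations -/

namespace DGOperad

variable {P : DGOperad} {e : P.obj 0 0} {μ : ∀ n : ℕ, P.obj n (-1)}

/-- The Leibniz rule `d_ins` for `x = μ w.length`. The first minus sign comes from `hμ`, the second
from the degree `-1` of `μ`. -/
theorem d_insMu (hμ : ∀ n, P.d (μ n) = -P.selfComp μ n) {n : ℕ} {w : List (Option Unit)}
    (hw : w.countP Option.isNone = n) :
    P.d (P.insMu e μ n w) = -(∑ s : Split w.length,
        P.insTriple e μ n (w.take s.p, (w.drop s.p).take s.q, (w.drop s.p).drop s.q))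
      - ∑ i ∈ Finset.range w.length, (if w[i]? = some (some ()) then
        P.insPair e μ (P.d e) n (w.take i, w.drop (i + 1)) else 0) := by
  rw [NSOperad.insMu, dif_pos hw.symm, P.d_ins e w (by norm_num), hμ, NSOperad.ins_neg,
    ksign_odd (by decide), neg_one_smul, ← sub_eq_add_neg, NSOperad.selfComp, NSOperad.ins_sum]
  congr 1
  · congr 1
    refine Finset.sum_congr rfl fun s _ => ?_
    have hs := s.sum_eq
    rw [← NSOperad.ins_comp_mu (l := s.p + 1 + s.r) (q := s.q) (p := s.p) (m := w.length)
      (by simp; omega) (by simp; omega) (by simp; omega) (by omega) (by omega) (by norm_num)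
      (by simp) (by simp [← hw])]
    -- What remains is that the three pieces concatenate to `w`.
    congr 1
    simp
  · refine Finset.sum_congr rfl fun i hi => ?_
    split_ifs
    · rw [Finset.mem_range] at hi
      exact NSOperad.insWith_mu (by simp; omega) _
    · rfl

theorem d_twistSum (hμ : ∀ n, P.d (μ n) = -P.selfComp μ n) (t n : ℕ) :
    P.d (P.twistSum e μ (t + 1) n) = -(∑ x ∈ wordTriples n (t + 1), P.insTriple e μ n x)
      - ∑ x ∈ wordPairs n t, P.insPair e μ (P.d e) n x := by
  rw [NSOperad.twistSum, map_sum,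
    Finset.sum_congr rfl fun w hw => d_insMu hμ (mem_words.1 hw).1,
    Finset.sum_sub_distrib, Finset.sum_neg_distrib, sum_words_splits n (t + 1) (P.insTriple e μ n),
    sum_words_letters n t (P.insPair e μ (P.d e) n)]

theorem insMu_mem (n : ℕ) (w : List (Option Unit)) :
    P.insMu e μ n w ∈ (P.countFiltration e).F (w.countP Option.isSome) n (-1) := by
  rw [NSOperad.insMu]
  split_ifs with h
  · have h' := HasCount.plug e (w.map (Option.map fun _ => e)) (by simp) (t := 0) (s := 0)
      (by simp) (h.trans (by simp [List.countP_map, Function.comp_def])) (μ w.length) (.any _)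
    simpa [List.countP_map, Function.comp_def] using! h'
  · exact zero_mem _

theorem insTriple_mem (n : ℕ)
    (x : List (Option Unit) × List (Option Unit) × List (Option Unit)) :
    P.insTriple e μ n x ∈ (P.countFiltration e).F (x.1.countP Option.isSome +
      x.2.1.countP Option.isSome + x.2.2.countP Option.isSome) n (-1 - 1) := by
  rw [NSOperad.insTriple]
  split_ifs with h
  · have h' := (P.countFiltration e).comp_mem (k := n) (x.1.countP Option.isNone) (by omega) (by omega)
      (show (-1 : ℤ) + -1 = -1 - 1 by norm_num)
      (insMu_mem (e := e) (μ := μ) (x.1.countP Option.isNone + 1 + x.2.2.countP Option.isNone)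
        (x.1 ++ none :: x.2.2)) (insMu_mem (μ := μ) (x.2.1.countP Option.isNone) x.2.1)
    refine (P.countFiltration e).antitone ?_ h'
    simp
    omega
  · exact zero_mem _

/-- The common terms cancel, so only the symmetric difference of the index sets matters. -/
theorem sum_sub_sum_mem {ι A : Type*} [DecidableEq ι] [AddCommGroup A] (H : AddSubgroup A)
    {S S' : Finset ι} {f : ι → A} (h : ∀ x ∈ S, x ∉ S' → f x ∈ H) (h' : ∀ x ∈ S', x ∉ S → f x ∈ H) :
    ∑ x ∈ S, f x - ∑ x ∈ S', f x ∈ H := by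
  rw [← Finset.sum_sdiff_sub_sum_sdiff]
  exact sub_mem (sum_mem fun x hx => h x (Finset.mem_sdiff.1 hx).1 (Finset.mem_sdiff.1 hx).2)
    (sum_mem fun x hx => h' x (Finset.mem_sdiff.1 hx).1 (Finset.mem_sdiff.1 hx).2)

/-- The twisted operations satisfy the curved `A∞` equation up to terms with `t` insertions. -/
theorem d_twist_add_selfComp_mem (hμ : ∀ n, P.d (μ n) = -P.selfComp μ n) (t n : ℕ) :
    P.d (NSOperad.inZero (P.d e) n + P.twistSum e μ (t + 1) n)
      + P.selfComp (fun n => NSOperad.inZero (P.d e) n + P.twistSum e μ t n) n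
      ∈ (P.countFiltration e).F t n (-1 - 1) := by
  classical
  -- For `e = α` this is `d κ = 0`.
  have h₀ : P.d (NSOperad.inZero (P.d e) n) = 0 := by
    cases n with
    | zero => exact P.d_d e
    | succ n => exact map_zero _
  rw [map_add, h₀, zero_add, d_twistSum hμ, NSOperad.selfComp_add_inZero]
  -- The pair sums cancel exactly. A triple in only one of the two index sets has at least `t`
  -- insertions: its total exceeds `t`, or the outer words together or the middle word alone already
  -- have `t`.
  have h : ∑ x ∈ wordTriples' n t, P.insTriple e μ n x
      - ∑ x ∈ wordTriples n (t + 1), P.insTriple e μ n x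
      ∈ (P.countFiltration e).F t n (-1 - 1) := by
    refine sum_sub_sum_mem _ (fun x hx hx' => ?_) fun x hx hx' => ?_
    all_goals
      rw [mem_wordTriples'] at *
      rw [mem_wordTriples] at *
      exact (P.countFiltration e).antitone (by omega) (insTriple_mem n x)
  convert h using 1
  abel

end DGOperad

/-! ### Words with `n` open inputs as tuples of exponents -/

theorem insertWord_map {Y Z : Type} (f : Y → Z) (y : Y) : ∀ {n : ℕ} (i : Fin (n + 1) → ℕ),
    insertWord (f y) i = (insertWord y i).map (Option.map f)
  | 0, i => by simp [insertWord]
  | n + 1, i => by simp [insertWord, insertWord_map f y (Fin.tail i)]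

theorem insertWord_injective {Y : Type} (y : Y) : ∀ {n : ℕ} {i j : Fin (n + 1) → ℕ},
    insertWord y i = insertWord y j → i = j
  | 0, i, j, h => by
    funext t
    obtain rfl : t = 0 := by omega
    simpa [insertWord] using congrArg List.length h
  | n + 1, i, j, h => by
    obtain ⟨h₁, h₂⟩ := List.append_none_cons_inj (by simp [List.countP_replicate]) h
    rw [← Fin.cons_self_tail i, ← Fin.cons_self_tail j, insertWord_injective y h₂]
    congr 1
    simpa using congrArg List.length h₁

theorem List.eq_replicate_of_countP_isNone {w : List (Option Unit)}
    (h : w.countP Option.isNone = 0) : w = List.replicate w.length (some ()) := by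
  refine List.eq_replicate_iff.2 ⟨rfl, fun c hc => ?_⟩
  rw [List.countP_eq_zero] at h
  cases c with
  | none => exact absurd rfl (h none hc)
  | some c => rfl

theorem exists_insertWord_eq : ∀ {n : ℕ} {w : List (Option Unit)}
    (_ : w.countP Option.isNone = n), ∃ i : Fin (n + 1) → ℕ, insertWord () i = w
  | 0, w, h => ⟨fun _ => w.length, (List.eq_replicate_of_countP_isNone h).symm⟩
  | n + 1, w, h => by
    obtain ⟨w₁, w₂, rfl, h₁, h₂⟩ :=
      List.exists_eq_append_none_cons (p := 0) (r := n) (h.trans (by omega))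
    obtain ⟨i, rfl⟩ := exists_insertWord_eq h₂
    refine ⟨Fin.cons w₁.length i, ?_⟩
    rw [insertWord, Fin.cons_zero, Fin.tail_cons, ← List.eq_replicate_of_countP_isNone h₁]

/-- A word with `n` letters `none` is determined by the lengths of its `n + 1` runs of `some ()`,
and any lengths occur. The first `t` terms of the series thus collect exactly the words with fewer
than `t` insertions. -/
theorem sum_insertWord {M : Type*} [AddCommMonoid M] (n t : ℕ) (f : List (Option Unit) → M) :
    ∑ s ∈ Finset.range t, ∑ i ∈ Finset.Nat.antidiagonalTuple (n + 1) s, f (insertWord () i)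
      = ∑ w ∈ words n t, f w := by
  rw [Finset.sum_sigma']
  refine Finset.sum_bij (fun x _ => insertWord () x.2) ?_ ?_ ?_ fun _ _ => rfl
  · rintro ⟨s, i⟩ hx
    simp only [Finset.mem_sigma, Finset.mem_range, Finset.Nat.mem_antidiagonalTuple] at hx
    rw [mem_words, insertWord_countP, insertWord_countP_isSome, hx.2]
    exact ⟨rfl, hx.1⟩
  · rintro ⟨s, i⟩ hx ⟨s', i'⟩ hx' h
    simp only [Finset.mem_sigma, Finset.mem_range, Finset.Nat.mem_antidiagonalTuple] at hx hx'
    obtain rfl := insertWord_injective () h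
    obtain rfl : s = s' := hx.2.symm.trans hx'.2
    rfl
  · intro w hw
    rw [mem_words] at hw
    obtain ⟨i, rfl⟩ := exists_insertWord_eq hw.1
    refine ⟨⟨∑ t, i t, i⟩, ?_, rfl⟩
    simp only [Finset.mem_sigma, Finset.mem_range, Finset.Nat.mem_antidiagonalTuple, and_true]
    rw [← insertWord_countP_isSome () i]
    exact hw.2

/-! ### The curved equation in the completed coproduct -/

/-- The operation `μ_n` in `cA∞ ∨ T`. -/
noncomputable def muIn (n : ℕ) : (cAinf.coprod opT).obj n (-1) :=
  (cAinf.coprodInl opT).map (cAinf.mu n)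

theorem d_muIn (n : ℕ) :
    (cAinf.coprod opT).d (muIn n) = -(cAinf.coprod opT).selfComp muIn n := by
  rw [muIn, ← DGOperad.Hom.map_d, cAinf.d_mu, map_neg, NSOperad.selfComp, map_sum]
  simp only [DGOperad.Hom.map_comp]
  rfl

theorem muAlpha_eq {n : ℕ} (i : Fin (n + 1) → ℕ) :
    muAlpha i = (cAinf.coprod opT).insMu (alphaIn cAinf) muIn n (insertWord () i) := by
  rw [NSOperad.insMu, dif_pos (insertWord_countP () i).symm]
  exact NSOperad.plug_congr _ muIn (insertWord_map (fun _ => alphaIn cAinf) () i) rfl _ _ _ _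

/-- The operations `κ + μ_0`, `μ_1`, `μ_2`, … of `cA∞ ∨ T` with fewer than `t` copies of
`α` inserted in all possible ways. -/
noncomputable def twistApprox (t n : ℕ) : (cAinf.coprod opT).obj n (-1) :=
  NSOperad.inZero ((cAinf.coprod opT).d (alphaIn cAinf)) n
    + (cAinf.coprod opT).twistSum (alphaIn cAinf) muIn t n

theorem muSeries_apply (n t : ℕ) :
    (muSeries n).1 t = ((cAinf.coprod opT).twistSum (alphaIn cAinf) muIn t n :
      (alphaFiltration cAinf).Quo t n (-1)) := by
  refine congrArg (QuotientAddGroup.mk (s := (alphaFiltration cAinf).F t n (-1))) ?_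
  simp only [muAlpha_eq]
  exact sum_insertWord n t _

theorem twistedMu_apply (n t : ℕ) :
    (twistedMu n).1 t = (twistApprox t n : (alphaFiltration cAinf).Quo t n (-1)) := by
  cases n with
  -- The elements `κ` and `d α` of the coproduct agree by definition.
  | zero => exact congrArg (_ + ·) (muSeries_apply 0 t)
  | succ n =>
    rw [twistApprox, NSOperad.inZero, zero_add]
    exact muSeries_apply (n + 1) t

namespace DGOperad.Filtration

variable {P : DGOperad} (Φ : P.Filtration)

/-- The projection of the completion to the quotient of level `t`. -/
def proj (t n : ℕ) (a : ℤ) : Φ.completion.obj n a →+ Φ.Quo t n a :=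
  AddMonoidHom.mk' (fun x => x.1 t) fun _ _ => rfl

theorem ext {n : ℕ} {a : ℤ} {x y : Φ.completion.obj n a}
    (h : ∀ t, Φ.proj t n a x = Φ.proj t n a y) : x = y :=
  Subtype.ext (funext h)

/-- Composition in the completion is computed level by level, so at level `t` it may be carried out
on representatives in `P`. -/
theorem proj_selfComp (ν : ∀ n, Φ.completion.obj n (-1)) (t : ℕ) (μ : ∀ n, P.obj n (-1))
    (h : ∀ n, Φ.proj t n (-1) (ν n) = (μ n : Φ.Quo t n (-1))) (n : ℕ) :
    Φ.proj t n (-1 - 1) (Φ.completion.selfComp ν n)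
      = (P.selfComp μ n : Φ.Quo t n (-1 - 1)) := by
  rw [NSOperad.selfComp, NSOperad.selfComp, map_sum,
    ← QuotientAddGroup.mk'_apply (Φ.F t n (-1 - 1)), map_sum]
  refine Finset.sum_congr rfl fun s _ => ?_
  exact congrArg₂ (Φ.compQuo t (k := n) s.p (by omega) (by have := s.sum_eq; omega)
    (show (-1 : ℤ) + -1 = -1 - 1 by norm_num)) (h _) (h _)

end DGOperad.Filtration

/-- Equality is checked in each quotient by `F^t`, where both sides have representatives in the
uncompleted coproduct. -/
theorem d_twistedMu (n : ℕ) :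
    (completedCoprodT cAinf).d (twistedMu n)
      = -(completedCoprodT cAinf).selfComp twistedMu n := by
  refine (alphaFiltration cAinf).ext fun t => ?_
  refine Eq.trans ?_ ((map_neg ((alphaFiltration cAinf).proj t n (-1 - 1)) _).trans
    (congrArg Neg.neg ((alphaFiltration cAinf).proj_selfComp twistedMu t
      (twistApprox t) (fun n => twistedMu_apply n t) n))).symm
  -- The differential lowers the filtration by one, so its level `t` is read off from level `t + 1`.
  -- This is the reason for comparing truncations at `t + 1` and at `t`.
  have h : (alphaFiltration cAinf).proj t n (-1 - 1) ((completedCoprodT cAinf).d (twistedMu n))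
      = (alphaFiltration cAinf).dQuo t n (-1) ((twistedMu n).1 (t + 1)) := rfl
  rw [h, twistedMu_apply]
  refine eq_neg_of_add_eq_zero_left ?_
  exact (QuotientAddGroup.eq_zero_iff _).2 (DGOperad.d_twist_add_selfComp_mem d_muIn t n)

theorem propositionA1 :
    ∃! η : DGOperad.Hom cAinf (completedCoprodT cAinf),
      ∀ n : ℕ, η.map (cAinf.mu n) = twistedMu n :=
  ⟨cAinf.lift _ twistedMu d_twistedMu, cAinf.lift_mu _ twistedMu d_twistedMu,
    fun _ h => cAinf.hom_ext fun n => (h n).trans (cAinf.lift_mu _ _ d_twistedMu n).symm⟩
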